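/- Let $d\ge 1$, $\alpha\in(1,2]$, and write $z=(x,v)\in\mathbb R^d\times\mathbb R^d=\mathbb R^{2d}$, $\boldsymbol a=(1+\alpha,1)$, $|z|_{\boldsymbol a}=|x|^{1/(1+\alpha)}+|v|$. For $\boldsymbol p=(p_x,p_v)\in[1,\infty]^2$ let $\|f\|_{\boldsymbol p}=\big\|v\mapsto\|f(\cdot,v)\|_{L^{p_x}(\mathbb R^d)}\big\|_{L^{p_v}(\mathbb R^d)}$, and put $\mathcal A_{\boldsymbol p,\boldsymbol r}=(1+\alpha)d\big(\tfrac1{p_x}-\tfrac1{r_x}\big)+d\big(\tfrac1{p_v}-\tfrac1{r_v}\big)$, $\boldsymbol 1=(1,1)$; inequalities between pairs are componentwise. Fix a symmetric $C^\infty$ function $\chi_0:\mathbb R^{2d}\to\mathbb R$ with $\chi_0(\xi)=1$ for $|\xi|_{\boldsymbol a}\le1$ and $\chi_0(\xi)=0$ for $|\xi|_{\boldsymbol a}>2$. With $2^{s\boldsymbol a}(\xi_1,\xi_2)=(2^{(1+\alpha)s}\xi_1,2^s\xi_2)$ let $\phi_0^{\boldsymbol a}=\chi_0$ and $\phi_j^{\boldsymbol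 a}(\xi)=\chi_0(2^{-j\boldsymbol a}\xi)-\chi_0(2^{-(j-1)\boldsymbol a}\xi)$ for $j\ge1$. For a tempered distribution $f$ let $\mathcal R_j^{\boldsymbol a}f=\check\phi_j^{\boldsymbol a}*f$, where $\check g(z)=(2\pi)^{-2d}\int e^{i\xi\cdot z}g(\xi)\,d\xi$, and $\|f\|_{\mathbf B^{s,1}_{\boldsymbol p;\boldsymbol a}}=\sum_{j\ge0}2^{js}\|\mathcal R^{\boldsymbol a}_jf\|_{\boldsymbol p}$. For a real Schwartz function $\phi$ on $\mathbb R^{2d}$ and $\lambda>0$ let $\phi_\lambda(x,v)=\lambda^{(2+\alpha)d}\phi(\lambda^{1+\alpha}x,\lambda v)$. Theorem C.3. Let $\phi$ be a real Schwartz function on $\mathbb R^{2d}$, let $\boldsymbol p_1\in[1,\infty)^2$ and $\boldsymbol p=(p_x,p_v)\in(1,\infty)^2$ with $\boldsymbol p_1\le\boldsymbol p$, and put $q=p_x\wedge p_v\wedge2$. If $\boldsymbol p_1=\boldsymbol p$ let $\ell=0$; otherwise let $\ell>\mathcal A_{\boldsymbol p_1,\boldsymbol p}$. Let $\beta<0$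 and let $m>1$ be an integer. Then there is a constant $C>0$, depending only on $d,\alpha,\chi_0,\phi,\boldsymbol p_1,\boldsymbol p,\ell,\beta,m$, such that for every probability measure $\mu$ on $\mathbb R^{2d}$ with $\int|z|_{\boldsymbol a}^{\ell m}\mu(dz)<\infty$, every $N\ge1$, all i.i.d. random variables $\xi_1,\dots,\xi_N$ in $\mathbb R^{2d}$ with law $\mu$ and empirical measure $\bar\mu_N=\frac1N\sum_{i=1}^N\delta_{\xi_i}$, and every real $\lambda\ge1$, the random variable $\|\phi_\lambda*(\bar\mu_N-\mu)\|_{\mathbf B^{\beta,1}_{\boldsymbol p_1;\boldsymbol a}}$ is measurable and $$\Big(\mathbb E\,\|\phi_\lambda*(\bar\mu_N-\mu)\|_{\mathbf B^{\beta,1}_{\boldsymbol p_1;\boldsymbol a}}^m\Big)^{1/m}\le C\,\big(1+\mathbb E|\xi_1|_{\boldsymbol a}^{\ell m}\big)^{1/m}\,N^{\frac1q-1}\,\lambda^{\mathcal A_{\boldsymbol 1,\boldsymbol p}}.$$ -/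

import Mathlib

open MeasureTheory ProbabilityTheory
open scoped ENNReal NNReal SchwartzMap FourierTransform

noncomputable section

namespace AnisoBesov

/-- The phase space `ℝ^{2d} = ℝ^d × ℝ^d`, with points `z = (x, v)` and the Euclidean structure. -/
abbrev Phase (d : ℕ) : Type :=
  WithLp 2 (EuclideanSpace ℝ (Fin d) × EuclideanSpace ℝ (Fin d))

/-- The anisotropic size `|z|_a = |x|^{1/(1+α)} + |v|` of `z = (x, v)`, where `a = (1+α, 1)`. -/
def anorm {d : ℕ} (α : ℝ) (z : Phase d) : ℝ :=
  ‖z.fst‖ ^ (1 / (1 + α)) + ‖z.snd‖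

/-- The quantity `𝒜_{p,q} = (1+α)d(1/p_x - 1/q_x) + d(1/p_v - 1/q_v)` for
`p = (p_x, p_v)` and `q = (q_x, q_v)` in `[1,∞]²`. -/
def gap (d : ℕ) (α : ℝ) (p q : ℝ≥0∞ × ℝ≥0∞) : ℝ :=
  (1 + α) * d * ((p.1⁻¹).toReal - (q.1⁻¹).toReal) + d * ((p.2⁻¹).toReal - (q.2⁻¹).toReal)

/-- The mixed Lebesgue norm `‖f‖_p`: the `L^{p_v}` norm in `v` of the `L^{p_x}` norm in `x`. -/
def mixedNorm {d : ℕ} (p : ℝ≥0∞ × ℝ≥0∞) (f : Phase d → ℂ) : ℝ≥0∞ :=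
  eLpNorm (fun v : EuclideanSpace ℝ (Fin d) =>
    eLpNorm (fun x : EuclideanSpace ℝ (Fin d) => f (WithLp.toLp 2 (x, v))) p.1 volume) p.2 volume

/-- The linear automorphism `(x, v) ↦ (a x, b v)` for `a, b ≠ 0`. -/
def scaleBy (d : ℕ) (a b : ℝ) (ha : a ≠ 0) (hb : b ≠ 0) : Phase d ≃L[ℝ] Phase d :=
  { toFun := fun z => WithLp.toLp 2 (a • z.fst, b • z.snd)
    invFun := fun z => WithLp.toLp 2 (a⁻¹ • z.fst, b⁻¹ • z.snd)
    map_add' := fun z w => by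
      simp only [WithLp.add_fst, WithLp.add_snd, smul_add]; rfl
    map_smul' := fun c z => by
      simp only [WithLp.smul_fst, WithLp.smul_snd, smul_comm _ c, RingHom.id_apply]; rfl
    left_inv := fun z => by
      change WithLp.toLp 2 (a⁻¹ • a • z.fst, b⁻¹ • b • z.snd) = z
      rw [inv_smul_smul₀ ha, inv_smul_smul₀ hb]; rfl
    right_inv := fun z => by
      change WithLp.toLp 2 (a • a⁻¹ • z.fst, b • b⁻¹ • z.snd) = z
      rw [smul_inv_smul₀ ha, smul_inv_smul₀ hb]; rfl
    continuous_toFun := by fun_prop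
    continuous_invFun := by fun_prop }

/-- The anisotropic scaling `2^{s a} ξ = (2^{(1+α)s} ξ₁, 2^s ξ₂)`. -/
def dyadicScale (d : ℕ) (α s : ℝ) : Phase d ≃L[ℝ] Phase d :=
  scaleBy d ((2 : ℝ) ^ ((1 + α) * s)) ((2 : ℝ) ^ s) (by positivity) (by positivity)

/-- A symmetric smooth cut-off `χ₀` which is `1` on `{|ξ|_a ≤ 1}` and `0` outside `{|ξ|_a ≤ 2}`.
(A smooth function with the last property has compact support, hence is a Schwartz function;
it is bundled as such.) -/
structure Cutoff (d : ℕ) (α : ℝ) where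
  /-- the cut-off function -/
  fn : 𝓢(Phase d, ℝ)
  symm : ∀ ξ, fn (-ξ) = fn ξ
  eq_one : ∀ ξ, anorm α ξ ≤ 1 → fn ξ = 1
  eq_zero : ∀ ξ, 2 < anorm α ξ → fn ξ = 0

/-- The dyadic partition of unity: `φ_0 = χ₀` and
`φ_j(ξ) = χ₀(2^{-j a} ξ) - χ₀(2^{-(j-1) a} ξ)` for `j ≥ 1`. -/
def Cutoff.piece {d : ℕ} {α : ℝ} (χ : Cutoff d α) : ℕ → 𝓢(Phase d, ℝ)
  | 0 => χ.fn
  | j + 1 =>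
      SchwartzMap.compCLMOfContinuousLinearEquiv ℝ (dyadicScale d α (-((j : ℝ) + 1))) χ.fn -
        SchwartzMap.compCLMOfContinuousLinearEquiv ℝ (dyadicScale d α (-(j : ℝ))) χ.fn

/-- The inverse Fourier transform `ǧ(z) = (2π)^{-2d} ∫ e^{i ξ·z} g(ξ) dξ` of a real Schwartz
function, written as the (unitary-frequency) transform `∫ e^{2π i η·z} g(2πη) dη`. -/
def invFourier {d : ℕ} (g : 𝓢(Phase d, ℝ)) : 𝓢(Phase d, ℂ) :=
  𝓕⁻ (SchwartzMap.postcompCLM Complex.ofRealCLM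
    (SchwartzMap.compCLMOfContinuousLinearEquiv ℝ
      (scaleBy d (2 * Real.pi) (2 * Real.pi) (by positivity) (by positivity)) g))

theorem invFourier_apply {d : ℕ} (g : 𝓢(Phase d, ℝ)) (z : Phase d) :
    invFourier g z = (((2 * Real.pi) ^ (2 * d))⁻¹ : ℝ) •
      ∫ ξ : Phase d, Complex.exp (Complex.I * (inner ℝ ξ z : ℝ)) * (g ξ : ℂ) := by
  have h := Measure.integral_comp_smul (volume : Measure (Phase d))
    (fun ξ => Complex.exp (Complex.I * (inner ℝ ξ z : ℝ)) * (g ξ : ℂ)) (2 * Real.pi)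
  have hr : Module.finrank ℝ (Phase d) = 2 * d := by
    rw [(WithLp.linearEquiv 2 ℝ _).finrank_eq]; simp; ring
  rw [hr, abs_of_nonneg (by positivity)] at h
  rw [← h]
  unfold invFourier
  rw [SchwartzMap.fourierInv_coe, Real.fourierInv_eq]
  congr 1; ext ξ
  rw [Circle.smul_def, smul_eq_mul]
  congr 1
  · rw [Real.fourierChar_apply, real_inner_smul_left]; congr 1; push_cast; ring

/-- The test function `y ↦ g(z - y)`. -/
def reflectAt {d : ℕ} (g : 𝓢(Phase d, ℂ)) (z : Phase d) : 𝓢(Phase d, ℂ) :=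
  SchwartzMap.compSubConstCLM ℂ z
    (SchwartzMap.compCLMOfContinuousLinearEquiv ℂ (ContinuousLinearEquiv.neg ℝ) g)

/-- The dyadic block `ℛ_j f = φ̌_j * f` of a tempered distribution `f`, i.e. the function
`z ↦ ⟨f, φ̌_j(z - ·)⟩`. -/
def Cutoff.block {d : ℕ} {α : ℝ} (χ : Cutoff d α) (j : ℕ) (f : 𝓢'(Phase d, ℂ))
    (z : Phase d) : ℂ :=
  f (reflectAt (invFourier (χ.piece j)) z)

/-- The anisotropic Besov norm
`‖f‖_{B^{s,q}_{p;a}} = (∑_{j ≥ 0} (2^{js} ‖ℛ_j f‖_p)^q)^{1/q}` (supremum over `j` if `q = ∞`). -/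
def Cutoff.besovNorm {d : ℕ} {α : ℝ} (χ : Cutoff d α) (s : ℝ) (q : ℝ≥0∞) (p : ℝ≥0∞ × ℝ≥0∞)
    (f : 𝓢'(Phase d, ℂ)) : ℝ≥0∞ :=
  eLpNorm (fun j : ℕ => ENNReal.ofReal ((2 : ℝ) ^ ((j : ℝ) * s)) * mixedNorm p (χ.block j f)) q
    Measure.count

/-- The dilation `φ_λ(x, v) = λ^{(2+α)d} φ(λ^{1+α} x, λ v)`. -/
def dilate {d : ℕ} (α lam : ℝ) (φ : Phase d → ℝ) (z : Phase d) : ℝ :=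
  lam ^ ((2 + α) * d) * φ (WithLp.toLp 2 (lam ^ (1 + α) • z.fst, lam • z.snd))

/-- The convolution `(f * ν)(z) = ∫ f(z - y) ν(dy)` of a function with a measure. -/
def conv {d : ℕ} (f : Phase d → ℝ) (ν : Measure (Phase d)) (z : Phase d) : ℝ :=
  ∫ y, f (z - y) ∂ν

/-- The empirical measure `N⁻¹ ∑_i δ_{x_i}`. -/
def empirical {d N : ℕ} (x : Fin N → Phase d) : Measure (Phase d) :=
  ((N : ℝ≥0)⁻¹) • ∑ i, Measure.dirac (x i)

instance {d N : ℕ} (x : Fin N → Phase d) : IsFiniteMeasure (empirical x) := by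
  unfold empirical; infer_instance

theorem memLp_conv {d : ℕ} (α lam : ℝ) (φ : 𝓢(Phase d, ℝ)) (ν : Measure (Phase d))
    [IsFiniteMeasure ν] : MemLp (conv (dilate α lam φ) ν) ∞ volume := by
  obtain ⟨K, hK⟩ : ∃ K, ∀ z, ‖φ z‖ ≤ K := by
    obtain ⟨K, -, hK⟩ := φ.decay 0 0
    exact ⟨K, fun z => by simpa using hK z⟩
  have hc : Continuous (dilate α lam φ) := by
    unfold dilate
    refine continuous_const.mul (φ.continuous.comp ?_)
    fun_prop
  have hb : ∀ z, ‖dilate α lam φ z‖ ≤ ‖lam ^ ((2 + α) * (d : ℝ))‖ * K := fun z => by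
    rw [dilate, norm_mul]
    gcongr
    exact hK _
  have hcont : Continuous (conv (dilate α lam φ) ν) := by
    unfold conv
    refine continuous_of_dominated (bound := fun _ => ‖lam ^ ((2 + α) * (d : ℝ))‖ * K)
      (fun z => ?_) (fun z => .of_forall fun y => hb _) (integrable_const _)
      (.of_forall fun y => by fun_prop)
    exact (hc.comp (continuous_const.sub continuous_id)).aestronglyMeasurable
  refine memLp_top_of_bound hcont.aestronglyMeasurable
    ((‖lam ^ ((2 + α) * (d : ℝ))‖ * K) * ν.real Set.univ) (.of_forall fun z => ?_)
  exact norm_integral_le_of_norm_le_const (.of_forall fun y => hb _)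

/-- The tempered distribution `φ_λ * (ν - μ)`: integration against the bounded continuous
function `z ↦ ∫ φ_λ(z - y) ν(dy) - ∫ φ_λ(z - y) μ(dy)`. -/
def mollifiedDiff {d : ℕ} (α lam : ℝ) (φ : 𝓢(Phase d, ℝ)) (ν μ : Measure (Phase d))
    [IsFiniteMeasure ν] [IsFiniteMeasure μ] : 𝓢'(Phase d, ℂ) :=
  Lp.toTemperedDistribution
    ((((memLp_conv α lam φ ν).sub (memLp_conv α lam φ μ)).ofReal (K := ℂ)).toLp
      (fun z => ((conv (dilate α lam φ) ν z - conv (dilate α lam φ) μ z : ℝ) : ℂ)))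

end AnisoBesov

end

open AnisoBesov

/-! Since β < 0, the weights 2^{jβ} are summable, so Minkowski reduces the claim to an L^m bound on
one dyadic block that is uniform in j. Write H for the convolution of φ̌_j with φ_λ. The j-th block
at z is N⁻¹ ∑ᵢ (H(z - ξᵢ) - 𝔼 H(z - ξᵢ)), an average of i.i.d. centered random functions, and three
ingredients bound it.

Weights. Hölder replaces the exponents p₁ by the larger p at the price of the factor W(x, v) = (1 +
|x|^{1/(1+α)})^k (1 + |v|)^l, where k + l = ℓ; the condition on ℓ makes the remaining power of W⁻¹
integrable (`exists_mixn_le_weighted`). W is submultiplicative, so a translate by u costs only a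
factor W(u), and ‖W(ξ₁)‖_{L^m} is controlled by the moment of order ℓm.

Type q. The weighted mixed space L^p behaves like a space of type q (`exists_lpn_centered_sum_le`):
symmetrize with an independent copy, insert random signs, apply Khintchine pointwise in z, and move
the norms past each other by Minkowski. Moving them requires q ≤ p_x, p_v, m, and passing from ℓ² to
ℓ^q requires q ≤ 2. The sum of N terms is then of size N^{1/q}, and dividing by N gives N^{1/q-1}.

Scaling. A weighted Young inequality gives ‖W H‖_p ≤ ‖W φ̌_j‖_{L¹} ‖W φ_λ‖_p. W does not decrease
under dilations by factors at least 1, so both norms scale no worse than without the weight: the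
first is bounded uniformly in j, the second by a multiple of λ^{𝒜_{1,p}}.

All quantities live in [0, ∞], so finiteness is checked only for the final constants. -/

noncomputable section

namespace AnisoBesov

/-! ### L^p norms in [0, ∞] and Minkowski's inequalities -/

section LpNorm

variable {X Y : Type*} [MeasurableSpace X] [MeasurableSpace Y]

/-- The `L^p` norm, for a real exponent, of a function with values in `[0, ∞]`. -/
def lpn (p : ℝ) (μ : Measure X) (f : X → ℝ≥0∞) : ℝ≥0∞ :=
  (∫⁻ x, f x ^ p ∂μ) ^ (1 / p)

theorem lpn_eq_eLpNorm {E : Type*} [ENorm E] {p : ℝ≥0∞} (hp : p ≠ 0) (hp' : p ≠ ∞)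
    (μ : Measure X) (f : X → E) : eLpNorm f p μ = lpn p.toReal μ (fun x => ‖f x‖ₑ) :=
  eLpNorm_eq_lintegral_rpow_enorm_toReal hp hp'

theorem lpn_one (μ : Measure X) (f : X → ℝ≥0∞) : lpn 1 μ f = ∫⁻ x, f x ∂μ := by
  simp [lpn]

theorem lpn_rpow {p : ℝ} (hp : 0 < p) (μ : Measure X) (f : X → ℝ≥0∞) :
    lpn p μ f ^ p = ∫⁻ x, f x ^ p ∂μ := by
  rw [lpn, ← ENNReal.rpow_mul, one_div_mul_cancel hp.ne', ENNReal.rpow_one]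

theorem lpn_mono {p : ℝ} (hp : 0 < p) {μ : Measure X} {f g : X → ℝ≥0∞} (h : ∀ x, f x ≤ g x) :
    lpn p μ f ≤ lpn p μ g := by
  unfold lpn
  gcongr with x
  exact h x

theorem lpn_const_mul {p : ℝ} (hp : 0 < p) (μ : Measure X) (c : ℝ≥0∞) {f : X → ℝ≥0∞}
    (hf : Measurable f) : lpn p μ (fun x => c * f x) = c * lpn p μ f := by
  simp only [lpn, ENNReal.mul_rpow_of_nonneg _ _ hp.le]
  rw [lintegral_const_mul _ (hf.pow_const p), ENNReal.mul_rpow_of_nonneg _ _ (by positivity),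
    ← ENNReal.rpow_mul, mul_one_div_cancel hp.ne', ENNReal.rpow_one]

theorem lpn_const {p : ℝ} (hp : 0 < p) (μ : Measure X) [IsProbabilityMeasure μ] (c : ℝ≥0∞) :
    lpn p μ (fun _ => c) = c := by
  simp only [lpn, lintegral_const, measure_univ, mul_one]
  rw [← ENNReal.rpow_mul, mul_one_div_cancel hp.ne', ENNReal.rpow_one]

theorem measurable_lpn {p : ℝ} (μ : Measure X) [SFinite μ] {F : X → Y → ℝ≥0∞}
    (hF : Measurable (Function.uncurry F)) : Measurable fun y => lpn p μ fun x => F x y := by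
  unfold lpn
  refine Measurable.pow_const ?_ _
  exact Measurable.lintegral_prod_left' (f := fun z : X × Y => F z.1 z.2 ^ p) (hF.pow_const p)

theorem measurable_lpn' {p : ℝ} (ν : Measure Y) [SFinite ν] {F : X → Y → ℝ≥0∞}
    (hF : Measurable (Function.uncurry F)) : Measurable fun x => lpn p ν (F x) :=
  measurable_lpn ν (F := fun y x => F x y) (hF.comp measurable_swap)

theorem lpn_mono_exponent {p q : ℝ} (hp : 0 < p) (hpq : p ≤ q) (μ : Measure X)
    [IsProbabilityMeasure μ] {f : X → ℝ≥0∞} (hf : Measurable f) : lpn p μ f ≤ lpn q μ f :=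
  eLpNorm'_le_eLpNorm'_of_exponent_le (f := f) hp hpq μ hf.aestronglyMeasurable

theorem lpn_add_le {p : ℝ} (hp : 1 ≤ p) {μ : Measure X} {f g : X → ℝ≥0∞} (hf : Measurable f)
    (hg : Measurable g) : lpn p μ (fun x => f x + g x) ≤ lpn p μ f + lpn p μ g :=
  ENNReal.lintegral_Lp_add_le hf.aemeasurable hg.aemeasurable hp

/-- Minkowski's integral inequality. -/
theorem lpn_lintegral_le {r : ℝ} (hr : 1 ≤ r) (μ : Measure X) [SFinite μ] (ν : Measure Y)
    [SFinite ν] {F : X → Y → ℝ≥0∞} (hF : Measurable (Function.uncurry F)) :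
    lpn r μ (fun x => ∫⁻ y, F x y ∂ν) ≤ ∫⁻ y, lpn r μ (fun x => F x y) ∂ν := by
  rcases hr.eq_or_lt with rfl | hr1
  · simp only [lpn_one]
    exact (lintegral_lintegral_swap hF.aemeasurable).le
  have hr0 : 0 < r := by linarith
  set n : Y → ℝ≥0∞ := fun y => lpn r μ fun x => F x y with hn
  have hnm : Measurable n := measurable_lpn μ hF
  set T := ∫⁻ y, n y ∂ν with hT
  by_cases hTtop : T = ∞
  · simp [hTtop]
  have hfin : ∀ᵐ y ∂ν, n y < ∞ := ae_lt_top hnm hTtop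
  have hFx : ∀ x, Measurable (F x) := fun x => hF.comp measurable_prodMk_left
  have hFy : ∀ y, Measurable fun x => F x y := fun y => hF.comp measurable_prodMk_right
  -- The proof divides by powers of n y, so the set where n vanishes is treated apart: there F(·, y)
  -- is zero almost everywhere, and Fubini for null sets exchanges the two quantifiers.
  have hzero : ∀ᵐ x ∂μ, ∀ᵐ y ∂ν, n y = 0 → F x y = 0 := by
    rw [Measure.ae_ae_comm (p := fun x y => n y = 0 → F x y = 0)]
    · refine .of_forall fun y => ?_
      by_cases hy : n y = 0
      · have h0 : ∫⁻ x, F x y ^ r ∂μ = 0 := by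
          rw [← lpn_rpow hr0]; change n y ^ r = 0; rw [hy, ENNReal.zero_rpow_of_pos hr0]
        rw [lintegral_eq_zero_iff ((hFy y).pow_const r)] at h0
        filter_upwards [h0] with x hx _
        simpa [hr0, hr0.not_gt, hr0.ne'] using hx
      · exact .of_forall fun x h => absurd h hy
    · have : {z : X × Y | n z.2 = 0 → F z.1 z.2 = 0} =
          {z | n z.2 = 0}ᶜ ∪ {z | F z.1 z.2 = 0} := by
        ext z; simp [imp_iff_not_or]
      change MeasurableSet {z : X × Y | n z.2 = 0 → F z.1 z.2 = 0}
      rw [this]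
      exact ((hnm.comp measurable_snd) (measurableSet_singleton 0)).compl.union
        (hF (measurableSet_singleton 0))
  have hconj : r.HolderConjugate (r.conjExponent) := .conjExponent hr1
  set s := r.conjExponent with hs
  have hs0 : 0 < s := hconj.symm.pos
  have hrs : r / s = r - 1 := by
    rw [hs, Real.conjExponent]; field_simp
  -- Hölder on F = (F n^{-1/s}) · n^{1/s}. The powers are chosen so that the second factor
  -- integrates to T and, after integration in x, F^r n^{1-r} becomes n.
  have hpt : ∀ᵐ x ∂μ, (∫⁻ y, F x y ∂ν) ^ r ≤
      T ^ (r - 1) * ∫⁻ y, F x y ^ r * n y ^ (1 - r) ∂ν := by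
    filter_upwards [hzero] with x hx
    have h1 : ∫⁻ y, F x y ∂ν ≤ ∫⁻ y, (F x y * n y ^ (-(1 / s))) * n y ^ (1 / s) ∂ν := by
      refine lintegral_mono_ae ?_
      filter_upwards [hx, hfin] with y hy hy'
      by_cases h0 : n y = 0
      · simp [hy h0]
      · rw [mul_assoc, ← ENNReal.rpow_add _ _ h0 hy'.ne]; simp
    have h2 := ENNReal.lintegral_mul_le_Lp_mul_Lq ν hconj
      ((hFx x).mul (hnm.pow_const (-(1 / s)))).aemeasurable (hnm.pow_const (1 / s)).aemeasurable
    calc (∫⁻ y, F x y ∂ν) ^ r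
        ≤ ((∫⁻ y, (F x y * n y ^ (-(1 / s))) ^ r ∂ν) ^ (1 / r) *
            (∫⁻ y, (n y ^ (1 / s)) ^ s ∂ν) ^ (1 / s)) ^ r := by
          gcongr
          exact h1.trans h2
      _ = T ^ (r - 1) * ∫⁻ y, F x y ^ r * n y ^ (1 - r) ∂ν := by
          rw [ENNReal.mul_rpow_of_nonneg _ _ hr0.le, ← ENNReal.rpow_mul,
            one_div_mul_cancel hr0.ne', ENNReal.rpow_one, ← ENNReal.rpow_mul, mul_comm]
          congr 1
          · simp only [← ENNReal.rpow_mul, one_div_mul_cancel hs0.ne', ENNReal.rpow_one]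
            rw [← hT, one_div_mul_eq_div, hrs]
          · refine lintegral_congr fun y => ?_
            rw [ENNReal.mul_rpow_of_nonneg _ _ hr0.le, ← ENNReal.rpow_mul]
            congr 2
            rw [neg_mul, one_div_mul_eq_div, hrs]; ring
  have hint : ∫⁻ x, (∫⁻ y, F x y ∂ν) ^ r ∂μ ≤ T ^ r := by
    have hm : Measurable fun z : X × Y => F z.1 z.2 ^ r * n z.2 ^ (1 - r) :=
      (hF.pow_const r).mul ((hnm.pow_const _).comp measurable_snd)
    calc ∫⁻ x, (∫⁻ y, F x y ∂ν) ^ r ∂μ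
        ≤ ∫⁻ x, T ^ (r - 1) * ∫⁻ y, F x y ^ r * n y ^ (1 - r) ∂ν ∂μ := lintegral_mono_ae hpt
      _ = T ^ (r - 1) * ∫⁻ x, ∫⁻ y, F x y ^ r * n y ^ (1 - r) ∂ν ∂μ :=
          lintegral_const_mul _ hm.lintegral_prod_right'
      _ = T ^ (r - 1) * ∫⁻ y, ∫⁻ x, F x y ^ r * n y ^ (1 - r) ∂μ ∂ν := by
          rw [lintegral_lintegral_swap hm.aemeasurable]
      _ ≤ T ^ (r - 1) * T := by
          gcongr
          refine lintegral_mono_ae ?_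
          filter_upwards [hfin] with y hy
          rw [lintegral_mul_const _ ((hFy y).pow_const r), ← lpn_rpow hr0]
          change n y ^ r * _ ≤ n y
          by_cases h0 : n y = 0
          · simp [h0, hr0]
          · rw [← ENNReal.rpow_add _ _ h0 hy.ne]; simp
      _ = T ^ r := by
          by_cases h0 : T = 0
          · simp [h0, hr0]
          · nth_rewrite 2 [← ENNReal.rpow_one T]
            rw [← ENNReal.rpow_add _ _ h0 hTtop]; simp
  calc lpn r μ (fun x => ∫⁻ y, F x y ∂ν) ≤ (T ^ r) ^ (1 / r) := by
        unfold lpn; gcongr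
    _ = T := by rw [← ENNReal.rpow_mul, mul_one_div_cancel hr0.ne', ENNReal.rpow_one]

/-- Minkowski's inequality for iterated norms: the larger exponent goes inside. -/
theorem lpn_lpn_le {p q : ℝ} (hq : 0 < q) (hqp : q ≤ p) (μ : Measure X) [SFinite μ]
    (ν : Measure Y) [SFinite ν] {F : X → Y → ℝ≥0∞} (hF : Measurable (Function.uncurry F)) :
    lpn p μ (fun x => lpn q ν (F x)) ≤ lpn q ν (fun y => lpn p μ fun x => F x y) := by
  have hp : 0 < p := hq.trans_le hqp
  -- Minkowski's integral inequality with exponent p / q, applied to F^q; the rest is bookkeeping of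
  -- exponents.
  have h := lpn_lintegral_le (r := p / q) ((one_le_div hq).2 hqp) μ ν
    (F := fun x y => F x y ^ q) (hF.pow_const q)
  have h' := ENNReal.rpow_le_rpow h (z := 1 / q) (by positivity)
  have e1 : 1 / q * p = p / q := by field_simp
  have e2 : 1 / (p / q) * (1 / q) = 1 / p := by field_simp
  have e3 : q * (p / q) = p := by field_simp
  have e4 : 1 / p * q = 1 / (p / q) := by field_simp
  simp only [lpn, ← ENNReal.rpow_mul, e1, e2, e3, e4] at h' ⊢
  exact h'

/-- Minkowski's integral inequality against the counting measure on ℕ. -/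
theorem lpn_tsum_le {p : ℝ} (hp : 1 ≤ p) (μ : Measure X) [SFinite μ] {f : ℕ → X → ℝ≥0∞}
    (hf : ∀ j, Measurable (f j)) :
    lpn p μ (fun x => ∑' j, f j x) ≤ ∑' j, lpn p μ (f j) := by
  have hF : Measurable (Function.uncurry fun x j => f j x) :=
    measurable_from_prod_countable_left hf
  simpa only [lintegral_count] using lpn_lintegral_le hp μ Measure.count hF

end LpNorm

/-! ### Random signs and Khintchine's inequality -/

section Khintchine

/-- The Rademacher measure on `Bool`. -/
def rad : Measure Bool :=
  (2⁻¹ : ℝ≥0∞) • (Measure.dirac true + Measure.dirac false)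

instance : IsProbabilityMeasure rad :=
  ⟨by simp [rad, ← two_mul, ENNReal.mul_inv_cancel]⟩

/-- The sign attached to a Boolean. -/
def sgn (b : Bool) : ℝ := if b then 1 else -1

theorem integral_rad (f : Bool → ℝ) : ∫ b, f b ∂rad = (f true + f false) / 2 := by
  rw [rad, integral_smul_measure, integral_add_measure Integrable.of_finite Integrable.of_finite,
    integral_dirac, integral_dirac]
  simp
  ring

variable {N : ℕ}

/-- The law of `N` independent random signs. -/
def signs (N : ℕ) : Measure (Fin N → Bool) := Measure.pi fun _ => rad

instance : IsProbabilityMeasure (signs N) := by unfold signs; infer_instance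

/-- Independence factors the integral, and each factor is cosh aᵢ ≤ exp(aᵢ²/2). -/
theorem integral_exp_signs_le (a : Fin N → ℝ) :
    ∫ ε, Real.exp (∑ i, sgn (ε i) * a i) ∂signs N ≤ Real.exp ((∑ i, a i ^ 2) / 2) := by
  simp only [Real.exp_sum, signs]
  rw [integral_fintype_prod_eq_prod (fun i (b : Bool) => Real.exp (sgn b * a i)), Finset.sum_div,
    Real.exp_sum]
  refine Finset.prod_le_prod (fun i _ => by positivity) fun i _ => ?_
  rw [integral_rad]
  refine le_trans (le_of_eq ?_) (Real.cosh_le_exp_half_sq (a i))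
  simp [sgn, Real.cosh_eq]

/-- After normalizing the coefficients to ℓ² norm 1, the bound |S|^M ≤ M! (e^S + e^{-S}) reduces
moments to the subgaussian exponential bound, with a constant independent of N. -/
theorem integral_abs_signs_pow_le (M : ℕ) (a : Fin N → ℝ) :
    ∫ ε, |∑ i, sgn (ε i) * a i| ^ M ∂signs N ≤
      (2 * M.factorial * Real.exp (1 / 2)) * (√(∑ i, a i ^ 2)) ^ M := by
  set s := √(∑ i, a i ^ 2) with hs
  have hs0 : 0 ≤ s := Real.sqrt_nonneg _
  have hs2 : s ^ 2 = ∑ i, a i ^ 2 := Real.sq_sqrt (by positivity)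
  rcases hs0.eq_or_lt with h0 | hpos
  · have ha : ∀ i, a i = 0 := by
      rw [← h0, zero_pow two_ne_zero, eq_comm, Finset.sum_eq_zero_iff_of_nonneg
        (fun i _ => sq_nonneg _)] at hs2
      intro i
      simpa using hs2 i (Finset.mem_univ i)
    rcases eq_or_ne M 0 with rfl | hM
    · simp only [pow_zero, integral_const, probReal_univ, smul_eq_mul, mul_one]
      have := Real.one_le_exp (x := 1 / 2) (by norm_num)
      simp only [Nat.factorial_zero, Nat.cast_one]
      linarith
    · simp only [ha, mul_zero, Finset.sum_const_zero, abs_zero, zero_pow hM, integral_zero]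
      positivity
  · have key : ∀ ε : Fin N → Bool, |∑ i, sgn (ε i) * a i| ^ M ≤ s ^ M * M.factorial *
        (Real.exp (∑ i, sgn (ε i) * (a i / s)) + Real.exp (∑ i, sgn (ε i) * (-(a i / s)))) := by
      intro ε
      set S := ∑ i, sgn (ε i) * (a i / s) with hS
      have e1 : ∑ i, sgn (ε i) * a i = s * S := by
        rw [hS, Finset.mul_sum]
        refine Finset.sum_congr rfl fun i _ => by field_simp
      have e2 : ∑ i, sgn (ε i) * (-(a i / s)) = -S := by
        simp [hS]
      rw [e1, e2, abs_mul, abs_of_pos hpos, mul_pow, mul_assoc]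
      gcongr
      have h1 := Real.pow_div_factorial_le_exp _ (abs_nonneg S) M
      rw [div_le_iff₀ (by positivity)] at h1
      have h2 : Real.exp |S| ≤ Real.exp S + Real.exp (-S) := by
        rcases abs_cases S with ⟨h, -⟩ | ⟨h, -⟩ <;> rw [h] <;>
          linarith [Real.exp_pos S, Real.exp_pos (-S)]
      calc |S| ^ M ≤ Real.exp |S| * M.factorial := h1
        _ ≤ _ := by rw [mul_comm]; gcongr
    have hn : ∑ i, (a i / s) ^ 2 = 1 := by
      simp only [div_pow, ← Finset.sum_div, ← hs2]
      field_simp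
    have hb1 := integral_exp_signs_le fun i => a i / s
    have hb2 := integral_exp_signs_le fun i => -(a i / s)
    simp only [neg_sq, hn] at hb1 hb2
    calc ∫ ε, |∑ i, sgn (ε i) * a i| ^ M ∂signs N
        ≤ ∫ ε, s ^ M * M.factorial * (Real.exp (∑ i, sgn (ε i) * (a i / s)) +
            Real.exp (∑ i, sgn (ε i) * (-(a i / s)))) ∂signs N :=
          integral_mono Integrable.of_finite Integrable.of_finite key
      _ = s ^ M * M.factorial * (∫ ε, Real.exp (∑ i, sgn (ε i) * (a i / s)) ∂signs N +
            ∫ ε, Real.exp (∑ i, sgn (ε i) * (-(a i / s))) ∂signs N) := by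
          rw [integral_const_mul, integral_add Integrable.of_finite Integrable.of_finite]
      _ ≤ s ^ M * M.factorial * (Real.exp (1 / 2) + Real.exp (1 / 2)) := by gcongr
      _ = _ := by ring

theorem lpn_abs_signs_le {M : ℕ} (hM : 0 < M) (a : Fin N → ℝ) :
    lpn M (signs N) (fun ε => ENNReal.ofReal |∑ i, sgn (ε i) * a i|) ≤
      ENNReal.ofReal ((2 * M.factorial * Real.exp (1 / 2)) ^ (1 / (M : ℝ)) *
        √(∑ i, a i ^ 2)) := by
  have hM' : (M : ℝ) ≠ 0 := by positivity
  have h : ∫⁻ ε, ENNReal.ofReal |∑ i, sgn (ε i) * a i| ^ (M : ℝ) ∂signs N ≤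
      ENNReal.ofReal ((2 * M.factorial * Real.exp (1 / 2)) * (√(∑ i, a i ^ 2)) ^ M) := by
    simp only [ENNReal.rpow_natCast, ← ENNReal.ofReal_pow (abs_nonneg _)]
    rw [← ofReal_integral_eq_lintegral_ofReal Integrable.of_finite
      (.of_forall fun _ => by positivity)]
    exact ENNReal.ofReal_le_ofReal (integral_abs_signs_pow_le M a)
  refine (ENNReal.rpow_le_rpow h (by positivity : 0 ≤ 1 / (M : ℝ))).trans (le_of_eq ?_)
  rw [ENNReal.ofReal_rpow_of_nonneg (by positivity) (by positivity),
    Real.mul_rpow (by positivity) (by positivity), ← Real.rpow_natCast (√_),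
    ← Real.rpow_mul (by positivity), mul_one_div_cancel hM', Real.rpow_one]

theorem rpow_sum_le_sum_rpow {ι : Type*} (s : Finset ι) (f : ι → ℝ≥0∞) {r : ℝ} (hr : 0 < r)
    (hr1 : r ≤ 1) : (∑ i ∈ s, f i) ^ r ≤ ∑ i ∈ s, f i ^ r := by
  classical
  induction s using Finset.induction_on with
  | empty => simp [hr]
  | insert i s hi ih =>
    rw [Finset.sum_insert hi, Finset.sum_insert hi]
    exact (ENNReal.rpow_add_le_add_rpow _ _ hr.le hr1).trans (by gcongr)

/-- The ℓ² norm is at most the ℓ^q norm, by subadditivity of t ↦ t^{q/2}; this is where q ≤ 2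
enters. -/
theorem ofReal_sqrt_sum_le {q : ℝ} (hq : 0 < q) (hq2 : q ≤ 2) (a : Fin N → ℂ) :
    ENNReal.ofReal (√(∑ i, ‖a i‖ ^ 2)) ≤ (∑ i, ‖a i‖ₑ ^ q) ^ (1 / q) := by
  have h := rpow_sum_le_sum_rpow Finset.univ (fun i => ‖a i‖ₑ ^ (2 : ℝ)) (r := q / 2)
    (by positivity) (by linarith)
  have h' := ENNReal.rpow_le_rpow h (z := 1 / q) (by positivity)
  have e1 : 2 * (q / 2) = q := by ring
  have e2 : q / 2 * (1 / q) = 1 / 2 := by field_simp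
  simp only [← ENNReal.rpow_mul, e1, e2] at h'
  refine le_trans (le_of_eq ?_) h'
  rw [Real.sqrt_eq_rpow, ← ENNReal.ofReal_rpow_of_nonneg (by positivity) (by positivity),
    ENNReal.ofReal_sum_of_nonneg (fun _ _ => by positivity)]
  congr 1
  refine Finset.sum_congr rfl fun i _ => ?_
  rw [ENNReal.ofReal_pow (norm_nonneg _), ofReal_norm, ← ENNReal.rpow_natCast]
  norm_num

/-- Khintchine's inequality, with the `ℓ^q` norm of the coefficients, `q ≤ 2`. -/
theorem exists_khintchine {M : ℕ} (hM : 0 < M) : ∃ K : ℝ≥0∞, K ≠ ∞ ∧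
    ∀ (q : ℝ), 0 < q → q ≤ 2 → ∀ (N : ℕ) (a : Fin N → ℂ),
      lpn M (signs N) (fun ε => ‖∑ i, (sgn (ε i) : ℂ) * a i‖ₑ) ≤
        K * lpn q Measure.count (fun i => ‖a i‖ₑ) := by
  set D : ℝ := (2 * M.factorial * Real.exp (1 / 2)) ^ (1 / (M : ℝ)) with hD
  have hD0 : 0 ≤ D := by positivity
  refine ⟨2 * ENNReal.ofReal D, by finiteness, fun q hq hq2 N a => ?_⟩
  have hM1 : (1 : ℝ) ≤ M := by exact_mod_cast hM
  have hpt : ∀ ε : Fin N → Bool, ‖∑ i, (sgn (ε i) : ℂ) * a i‖ₑ ≤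
      ENNReal.ofReal |∑ i, sgn (ε i) * (a i).re| + ENNReal.ofReal |∑ i, sgn (ε i) * (a i).im| := by
    intro ε
    rw [← ofReal_norm, ← ENNReal.ofReal_add (abs_nonneg _) (abs_nonneg _)]
    refine ENNReal.ofReal_le_ofReal ((Complex.norm_le_abs_re_add_abs_im _).trans (le_of_eq ?_))
    simp
  have hbd : ∀ c : Fin N → ℝ, (∀ i, |c i| ≤ ‖a i‖) →
      lpn M (signs N) (fun ε => ENNReal.ofReal |∑ i, sgn (ε i) * c i|) ≤
        ENNReal.ofReal D * lpn q Measure.count (fun i => ‖a i‖ₑ) := by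
    intro c hc
    refine (lpn_abs_signs_le hM c).trans ?_
    rw [← hD, ENNReal.ofReal_mul hD0]
    gcongr
    refine le_trans (ENNReal.ofReal_le_ofReal (Real.sqrt_le_sqrt
      (Finset.sum_le_sum fun i _ => ?_))) ((ofReal_sqrt_sum_le hq hq2 a).trans (le_of_eq ?_))
    · rw [← sq_abs]; gcongr; exact hc i
    · rw [lpn, lintegral_count, tsum_fintype]
  calc lpn M (signs N) (fun ε => ‖∑ i, (sgn (ε i) : ℂ) * a i‖ₑ)
      ≤ lpn M (signs N) (fun ε => ENNReal.ofReal |∑ i, sgn (ε i) * (a i).re| +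
          ENNReal.ofReal |∑ i, sgn (ε i) * (a i).im|) := lpn_mono (by positivity) hpt
    _ ≤ _ := lpn_add_le hM1 (measurable_of_finite _) (measurable_of_finite _)
    _ ≤ _ := add_le_add (hbd _ fun i => Complex.abs_re_le_norm _)
          (hbd _ fun i => Complex.abs_im_le_norm _)
    _ = _ := by ring

end Khintchine

/-! ### Mixed Lebesgue norms: Minkowski, translation and scaling -/

section MixedNorm

variable {d : ℕ} {Y : Type*} [MeasurableSpace Y]

/-- The mixed Lebesgue norm with finite exponents of a `[0, ∞]`-valued function. -/
def mixn (a b : ℝ) (F : Phase d → ℝ≥0∞) : ℝ≥0∞ :=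
  lpn b volume fun v : EuclideanSpace ℝ (Fin d) =>
    lpn a volume fun x : EuclideanSpace ℝ (Fin d) => F (WithLp.toLp 2 (x, v))

theorem mixedNorm_eq_mixn {p : ℝ≥0∞ × ℝ≥0∞} (hx : p.1 ≠ 0) (hx' : p.1 ≠ ∞) (hv : p.2 ≠ 0)
    (hv' : p.2 ≠ ∞) (f : Phase d → ℂ) :
    mixedNorm p f = mixn p.1.toReal p.2.toReal fun z => ‖f z‖ₑ := by
  rw [mixedNorm, lpn_eq_eLpNorm hv hv']
  simp only [lpn_eq_eLpNorm hx hx', enorm_eq_self, mixn]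

theorem measurable_toLp_pair :
    Measurable fun z : EuclideanSpace ℝ (Fin d) × EuclideanSpace ℝ (Fin d) =>
      (WithLp.toLp 2 z : Phase d) :=
  WithLp.measurable_toLp 2 _

theorem measurable_slice_left {F : Phase d → ℝ≥0∞} (hF : Measurable F)
    (v : EuclideanSpace ℝ (Fin d)) :
    Measurable fun x : EuclideanSpace ℝ (Fin d) => F (WithLp.toLp 2 (x, v)) :=
  hF.comp (measurable_toLp_pair.comp measurable_prodMk_right)

theorem measurable_slice {F : Phase d → ℝ≥0∞} (hF : Measurable F) (a : ℝ) :
    Measurable fun v : EuclideanSpace ℝ (Fin d) =>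
      lpn a volume fun x : EuclideanSpace ℝ (Fin d) => F (WithLp.toLp 2 (x, v)) :=
  measurable_lpn volume (F := fun x v => F (WithLp.toLp 2 (x, v))) (hF.comp measurable_toLp_pair)

theorem measurable_slice_param {F : Phase d → Y → ℝ≥0∞} (hF : Measurable (Function.uncurry F))
    (a : ℝ) : Measurable (Function.uncurry fun (v : EuclideanSpace ℝ (Fin d)) (y : Y) =>
      lpn a volume fun x : EuclideanSpace ℝ (Fin d) => F (WithLp.toLp 2 (x, v)) y) := by
  refine measurable_lpn volume
    (F := fun x (z : EuclideanSpace ℝ (Fin d) × Y) => F (WithLp.toLp 2 (x, z.1)) z.2) ?_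
  refine hF.comp (Measurable.prodMk (measurable_toLp_pair.comp ?_) ?_) <;> fun_prop

theorem measurable_mixn {F : Phase d → Y → ℝ≥0∞} (hF : Measurable (Function.uncurry F))
    (a b : ℝ) : Measurable fun y => mixn a b fun z => F z y :=
  measurable_lpn volume (measurable_slice_param hF a)

variable {a b : ℝ}

theorem mixn_mono (ha : 0 < a) (hb : 0 < b) {F G : Phase d → ℝ≥0∞} (h : ∀ z, F z ≤ G z) :
    mixn a b F ≤ mixn a b G :=
  lpn_mono hb fun _ => lpn_mono ha fun _ => h _

theorem mixn_const_mul (ha : 0 < a) (hb : 0 < b) (c : ℝ≥0∞) {F : Phase d → ℝ≥0∞}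
    (hF : Measurable F) : mixn a b (fun z => c * F z) = c * mixn a b F := by
  simp only [mixn, lpn_const_mul ha _ c (measurable_slice_left hF _)]
  exact lpn_const_mul hb _ c (measurable_slice hF a)

theorem mixn_add_le (ha : 1 ≤ a) (hb : 1 ≤ b) {F G : Phase d → ℝ≥0∞}
    (hF : Measurable F) (hG : Measurable G) :
    mixn a b (fun z => F z + G z) ≤ mixn a b F + mixn a b G :=
  (lpn_mono (by linarith) fun v => lpn_add_le ha (measurable_slice_left hF v)
    (measurable_slice_left hG v)).trans
    (lpn_add_le hb (measurable_slice hF a) (measurable_slice hG a))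

/-- Minkowski used twice, once per variable: an inner exponent below both a and b moves out. Used
with r = 1 for integrals and with r = q for ℓ^q sums. -/
theorem mixn_lpn_le {r : ℝ} (hr : 0 < r) (hra : r ≤ a) (hrb : r ≤ b) (ν : Measure Y) [SFinite ν]
    {F : Phase d → Y → ℝ≥0∞} (hF : Measurable (Function.uncurry F)) :
    mixn a b (fun z => lpn r ν (F z)) ≤ lpn r ν fun y => mixn a b fun z => F z y := by
  refine (lpn_mono (hr.trans_le hrb) fun v => lpn_lpn_le hr hra volume ν
    (F := fun x y => F (WithLp.toLp 2 (x, v)) y) ?_).trans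
    (lpn_lpn_le hr hrb volume ν (measurable_slice_param hF a))
  refine hF.comp (Measurable.prodMk (measurable_toLp_pair.comp ?_) ?_) <;> fun_prop

/-- The opposite exchange: an outer exponent above both a and b moves in, which makes Khintchine
applicable at each fixed point. -/
theorem lpn_mixn_le {M : ℝ} (ha : 0 < a) (hb : 0 < b) (haM : a ≤ M) (hbM : b ≤ M) (ν : Measure Y)
    [SFinite ν] {F : Phase d → Y → ℝ≥0∞} (hF : Measurable (Function.uncurry F)) :
    lpn M ν (fun y => mixn a b fun z => F z y) ≤ mixn a b fun z => lpn M ν (F z) := by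
  refine (lpn_lpn_le hb hbM ν volume
      (F := fun y v => lpn a volume fun x => F (WithLp.toLp 2 (x, v)) y)
      ((measurable_slice_param hF a).comp measurable_swap)).trans
    (lpn_mono hb fun v => lpn_lpn_le ha haM ν volume
      (F := fun y x => F (WithLp.toLp 2 (x, v)) y) ?_)
  refine hF.comp (Measurable.prodMk (measurable_toLp_pair.comp ?_) ?_) <;> fun_prop

theorem mixn_translate (F : Phase d → ℝ≥0∞) (u : Phase d) :
    mixn a b (fun z => F (z - u)) = mixn a b F := by
  have h : ∀ x v : EuclideanSpace ℝ (Fin d), (WithLp.toLp 2 (x, v) - u : Phase d) =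
    WithLp.toLp 2 (x - u.fst, v - u.snd) := fun x v => rfl
  have hx : ∀ v, lpn a volume (fun x => F (WithLp.toLp 2 (x - u.fst, v))) =
      lpn a volume (fun x => F (WithLp.toLp 2 (x, v))) := fun v => by
    rw [lpn, lpn, lintegral_sub_right_eq_self (fun x => F (WithLp.toLp 2 (x, v)) ^ a)]
  simp only [mixn, h, hx]
  rw [lpn, lpn, lintegral_sub_right_eq_self
    (fun v => lpn a volume (fun x => F (WithLp.toLp 2 (x, v))) ^ b)]

theorem lpn_comp_smul (ha : 0 < a) {s : ℝ} (hs : 0 < s) {f : EuclideanSpace ℝ (Fin d) → ℝ≥0∞}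
    (hf : Measurable f) : lpn a volume (fun x => f (s • x)) =
      ENNReal.ofReal (s ^ (-(d / a))) * lpn a volume f := by
  have h : ∫⁻ x, f (s • x) ^ a = ENNReal.ofReal (s ^ (-(d : ℝ))) * ∫⁻ x, f x ^ a := by
    have h1 := lintegral_map (μ := (volume : Measure (EuclideanSpace ℝ (Fin d))))
      (hf.pow_const a) (measurable_const_smul s)
    rw [← h1, Measure.map_addHaar_smul _ hs.ne', lintegral_smul_measure, smul_eq_mul]
    congr 2
    rw [finrank_euclideanSpace_fin, abs_of_pos (by positivity), Real.rpow_neg hs.le,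
      Real.rpow_natCast]
  rw [lpn, h, ENNReal.mul_rpow_of_nonneg _ _ (by positivity),
    ENNReal.ofReal_rpow_of_pos (by positivity), ← Real.rpow_mul hs.le, lpn]
  congr 3
  ring

theorem mixn_comp_scale (ha : 0 < a) (hb : 0 < b) {s t : ℝ} (hs : 0 < s) (ht : 0 < t)
    {F : Phase d → ℝ≥0∞} (hF : Measurable F) :
    mixn a b (fun z => F (WithLp.toLp 2 (s • z.fst, t • z.snd))) =
      ENNReal.ofReal (s ^ (-(d / a)) * t ^ (-(d / b))) * mixn a b F := by
  have h1 : ∀ v, lpn a volume (fun x => F (WithLp.toLp 2 (s • x, t • v))) =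
      ENNReal.ofReal (s ^ (-(d / a))) * lpn a volume (fun x => F (WithLp.toLp 2 (x, t • v))) :=
    fun v => lpn_comp_smul ha hs (measurable_slice_left hF _)
  have h2 := lpn_comp_smul hb ht (measurable_slice hF a)
  change lpn b volume (fun v => lpn a volume fun x => F (WithLp.toLp 2 (s • x, t • v))) = _
  simp only [h1]
  rw [lpn_const_mul hb, h2, ← mul_assoc, ENNReal.ofReal_mul (by positivity), mixn]
  exact (measurable_slice hF a).comp (measurable_const_smul t)

end MixedNorm

/-! ### Submultiplicative weights and changes of exponent -/

section Weight

variable {d : ℕ}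

/-- The weight `(1 + |x|^{1/a})^l`. -/
def wt (a l : ℝ) (x : EuclideanSpace ℝ (Fin d)) : ℝ≥0∞ :=
  ENNReal.ofReal ((1 + ‖x‖ ^ (1 / a)) ^ l)

theorem measurable_wt (a l : ℝ) : Measurable (wt (d := d) a l) := by
  unfold wt
  fun_prop

theorem one_le_wt (a : ℝ) {l : ℝ} (hl : 0 ≤ l) (x : EuclideanSpace ℝ (Fin d)) : 1 ≤ wt a l x := by
  rw [wt, ENNReal.one_le_ofReal]
  exact Real.one_le_rpow (le_add_of_nonneg_right (by positivity)) hl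

theorem wt_ne_top (a l : ℝ) (x : EuclideanSpace ℝ (Fin d)) : wt a l x ≠ ∞ := ENNReal.ofReal_ne_top

/-- For a ≥ 1 the power t^{1/a} is subadditive, and 1 + s + t ≤ (1 + s)(1 + t). -/
theorem wt_add_le {a l : ℝ} (ha : 1 ≤ a) (hl : 0 ≤ l) (x y : EuclideanSpace ℝ (Fin d)) :
    wt a l (x + y) ≤ wt a l x * wt a l y := by
  rw [wt, wt, wt, ← ENNReal.ofReal_mul (by positivity), ← Real.mul_rpow (by positivity)
    (by positivity)]
  refine ENNReal.ofReal_le_ofReal (Real.rpow_le_rpow (by positivity) ?_ hl)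
  have h1 : ‖x + y‖ ^ (1 / a) ≤ ‖x‖ ^ (1 / a) + ‖y‖ ^ (1 / a) :=
    (Real.rpow_le_rpow (norm_nonneg _) (norm_add_le x y) (by positivity)).trans
      (Real.rpow_add_le_add_rpow (norm_nonneg _) (norm_nonneg _) (by positivity)
        ((div_le_one (by linarith)).2 ha))
  have h2 : 0 ≤ ‖x‖ ^ (1 / a) * ‖y‖ ^ (1 / a) := by positivity
  linarith

theorem wt_le_wt_smul {a l : ℝ} (ha : 1 ≤ a) (hl : 0 ≤ l) {s : ℝ} (hs : 1 ≤ s)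
    (x : EuclideanSpace ℝ (Fin d)) : wt a l x ≤ wt a l (s • x) := by
  unfold wt
  gcongr
  rw [norm_smul, Real.norm_of_nonneg (by linarith)]
  exact le_mul_of_one_le_left (norm_nonneg _) hs

theorem lpn_one_add_norm_lt_top {p s : ℝ} (hp : 0 < p) (h : d < s * p) :
    lpn p volume (fun x : EuclideanSpace ℝ (Fin d) => ENNReal.ofReal ((1 + ‖x‖) ^ (-s))) < ∞ := by
  have h1 : ∀ x : EuclideanSpace ℝ (Fin d), ENNReal.ofReal ((1 + ‖x‖) ^ (-s)) ^ p =
      ENNReal.ofReal ((1 + ‖x‖) ^ (-(s * p))) := fun x => by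
    rw [ENNReal.ofReal_rpow_of_nonneg (by positivity) hp.le, ← Real.rpow_mul (by positivity),
      neg_mul]
  simp only [lpn, h1]
  refine ENNReal.rpow_lt_top_of_nonneg (by positivity) (ne_of_lt ?_)
  exact finite_integral_one_add_norm (by simpa using h)

/-- Lowering the exponent at the price of a weight. -/
theorem exists_lpn_le_weighted {a l p₁ p : ℝ} (ha : 1 ≤ a) (hl : 0 ≤ l) (hp₁ : 0 < p₁)
    (h : p₁ = p ∨ (p₁ < p ∧ a * d * (1 / p₁ - 1 / p) < l)) :
    ∃ C : ℝ≥0∞, C ≠ ∞ ∧ ∀ f : EuclideanSpace ℝ (Fin d) → ℝ≥0∞, Measurable f →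
      lpn p₁ volume f ≤ C * lpn p volume fun x => wt a l x * f x := by
  have ha0 : 0 < a := by linarith
  rcases h with rfl | ⟨hlt, hgap⟩
  · refine ⟨1, by simp, fun f _ => ?_⟩
    rw [one_mul]
    exact lpn_mono hp₁ fun x => le_mul_of_one_le_left zero_le (one_le_wt a hl x)
  have hp : 0 < p := hp₁.trans hlt
  have hδ : 0 < 1 / p₁ - 1 / p := sub_pos.2 (one_div_lt_one_div_of_lt hp₁ hlt)
  -- The Hölder partner, 1/p₁ = 1/p + 1/r. The weight's inverse is at most (1 + |x|)^{-l/a}, which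
  -- lies in L^r exactly when d < lr/a, that is, under the gap hypothesis.
  set r : ℝ := 1 / (1 / p₁ - 1 / p) with hr
  have hr0 : 0 < r := by positivity
  have hinv : 1 / p₁ = 1 / p + 1 / r := by rw [hr, one_div_one_div]; ring
  refine ⟨lpn r volume fun x : EuclideanSpace ℝ (Fin d) =>
    ENNReal.ofReal ((1 + ‖x‖) ^ (-(l / a))), (lpn_one_add_norm_lt_top hr0 ?_).ne, fun f hf => ?_⟩
  · rw [hr, mul_one_div, lt_div_iff₀ hδ, lt_div_iff₀ ha0]
    linarith
  have hle : ∀ x : EuclideanSpace ℝ (Fin d),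
      (wt a l x)⁻¹ ≤ ENNReal.ofReal ((1 + ‖x‖) ^ (-(l / a))) := fun x => by
    rw [wt, ← ENNReal.ofReal_inv_of_pos (by positivity), ← Real.rpow_neg (by positivity)]
    refine ENNReal.ofReal_le_ofReal ?_
    rw [Real.rpow_neg (by positivity), Real.rpow_neg (by positivity)]
    refine inv_anti₀ (by positivity) ?_
    rw [show l / a = 1 / a * l by ring, Real.rpow_mul (by positivity)]
    refine Real.rpow_le_rpow (by positivity) ?_ hl
    simpa using Real.rpow_add_le_add_rpow zero_le_one (norm_nonneg x) (p := 1 / a) (by positivity)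
      ((div_le_one ha0).2 ha)
  have hH := ENNReal.lintegral_Lp_mul_le_Lq_mul_Lr hp₁ hlt hinv
    (volume : Measure (EuclideanSpace ℝ (Fin d)))
    ((measurable_wt a l).mul hf).aemeasurable (measurable_wt a l).inv.aemeasurable
  calc lpn p₁ volume f
      ≤ lpn p₁ volume (fun x => (wt a l x * f x) * (wt a l x)⁻¹) := by
        refine lpn_mono hp₁ fun x => le_of_eq ?_
        rw [mul_comm, ← mul_assoc, ENNReal.inv_mul_cancel
          (zero_lt_one.trans_le (one_le_wt a hl x)).ne' (wt_ne_top a l x), one_mul]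
    _ ≤ lpn p volume (fun x => wt a l x * f x) * lpn r volume (fun x => (wt a l x)⁻¹) := hH
    _ ≤ _ := by
        rw [mul_comm]
        gcongr
        exact lpn_mono hr0 hle

/-- The weight `(1 + |x|^{1/(1+α)})^k (1 + |v|)^l` on phase space. -/
def phaseWt (α k l : ℝ) (z : Phase d) : ℝ≥0∞ := wt (1 + α) k z.fst * wt 1 l z.snd

theorem measurable_phaseWt (α k l : ℝ) : Measurable (phaseWt (d := d) α k l) := by
  unfold phaseWt
  have h := WithLp.measurable_ofLp 2 (EuclideanSpace ℝ (Fin d) × EuclideanSpace ℝ (Fin d))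
  exact ((measurable_wt _ _).comp (measurable_fst.comp h)).mul
    ((measurable_wt _ _).comp (measurable_snd.comp h))

variable {α k l : ℝ}

theorem phaseWt_add_le (hα : 0 ≤ α) (hk : 0 ≤ k) (hl : 0 ≤ l) (z w : Phase d) :
    phaseWt α k l (z + w) ≤ phaseWt α k l z * phaseWt α k l w := by
  unfold phaseWt
  rw [mul_mul_mul_comm]
  exact mul_le_mul' (wt_add_le (by linarith) hk _ _) (wt_add_le le_rfl hl _ _)

theorem phaseWt_le_scale (hα : 0 ≤ α) (hk : 0 ≤ k) (hl : 0 ≤ l) {s t : ℝ} (hs : 1 ≤ s)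
    (ht : 1 ≤ t) (z : Phase d) :
    phaseWt α k l z ≤ phaseWt α k l (WithLp.toLp 2 (s • z.fst, t • z.snd)) :=
  mul_le_mul' (wt_le_wt_smul (by linarith) hk hs _) (wt_le_wt_smul le_rfl hl ht _)

/-- Lowering the exponents of a mixed norm at the price of a weight. -/
theorem exists_mixn_le_weighted {a₁ b₁ a b : ℝ} (hα : 0 ≤ α) (hk : 0 ≤ k) (hl : 0 ≤ l)
    (ha₁ : 0 < a₁) (hb₁ : 0 < b₁) (ha : 0 < a)
    (hx : a₁ = a ∨ (a₁ < a ∧ (1 + α) * d * (1 / a₁ - 1 / a) < k))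
    (hv : b₁ = b ∨ (b₁ < b ∧ d * (1 / b₁ - 1 / b) < l)) :
    ∃ C : ℝ≥0∞, C ≠ ∞ ∧ ∀ F : Phase d → ℝ≥0∞, Measurable F →
      mixn a₁ b₁ F ≤ C * mixn a b fun z => phaseWt α k l z * F z := by
  obtain ⟨C₁, hC₁, h₁⟩ := exists_lpn_le_weighted (d := d) (by linarith) hk ha₁ hx
  obtain ⟨C₂, hC₂, h₂⟩ := exists_lpn_le_weighted (d := d) le_rfl hl hb₁
    (by simpa only [one_mul] using hv)
  refine ⟨C₁ * C₂, ENNReal.mul_ne_top hC₁ hC₂, fun F hF => ?_⟩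
  set G : Phase d → ℝ≥0∞ := fun z => wt (1 + α) k z.fst * F z with hG
  have hofLp := WithLp.measurable_ofLp 2 (EuclideanSpace ℝ (Fin d) × EuclideanSpace ℝ (Fin d))
  have hGm : Measurable G := ((measurable_wt _ _).comp (measurable_fst.comp hofLp)).mul hF
  have hGs := measurable_slice hGm a
  calc mixn a₁ b₁ F
      ≤ lpn b₁ volume (fun v => C₁ * lpn a volume fun x => G (WithLp.toLp 2 (x, v))) :=
        lpn_mono hb₁ fun v => h₁ _ (measurable_slice_left hF v)
    _ = C₁ * lpn b₁ volume (fun v => lpn a volume fun x => G (WithLp.toLp 2 (x, v))) :=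
        lpn_const_mul hb₁ _ _ hGs
    _ ≤ C₁ * (C₂ * lpn b volume fun v => wt 1 l v *
          lpn a volume fun x => G (WithLp.toLp 2 (x, v))) := by
        gcongr
        exact h₂ _ hGs
    _ = C₁ * C₂ * mixn a b fun z => phaseWt α k l z * F z := by
        rw [mul_assoc]
        congr 3
        funext v
        rw [← lpn_const_mul ha _ _ (measurable_slice_left hGm v)]
        congr 1
        funext x
        change wt 1 l v * (wt (1 + α) k x * _) = wt (1 + α) k x * wt 1 l v * _
        ring

theorem mixn_one_one {F : Phase d → ℝ≥0∞} (hF : Measurable F) : mixn 1 1 F = ∫⁻ z, F z := by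
  simp only [mixn, lpn_one]
  have h := WithLp.volume_preserving_toLp (EuclideanSpace ℝ (Fin d)) (EuclideanSpace ℝ (Fin d))
  rw [← h.lintegral_comp hF]
  exact lintegral_lintegral_symm (f := fun v x => F (WithLp.toLp 2 (x, v)))
    (hF.comp (measurable_toLp_pair.comp measurable_swap)).aemeasurable

/-- Schwartz decay beats the polynomial weight; it is spent separately in x and v so that the mixed
norm factors. -/
theorem mixn_phaseWt_mul_schwartz_lt_top {E : Type*} [NormedAddCommGroup E] [NormedSpace ℝ E]
    {a b : ℝ} (hα : 0 ≤ α) (hk : 0 ≤ k) (hl : 0 ≤ l) (ha : 0 < a) (hb : 0 < b)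
    (f : 𝓢(Phase d, E)) : mixn a b (fun z => phaseWt α k l z * ‖f z‖ₑ) < ∞ := by
  -- Decay of order 2n in z supplies order n in each variable; n must absorb the weight and leave
  -- integrability in L^a and L^b.
  obtain ⟨n, hn⟩ := exists_nat_gt (max (k + d / a) (l + d / b))
  have hn1 : k + d / a < n := (le_max_left _ _).trans_lt hn
  have hn2 : l + d / b < n := (le_max_right _ _).trans_lt hn
  set D := 2 ^ (2 * n) * ((Finset.Iic (2 * n, 0)).sup fun m => SchwartzMap.seminorm ℝ m.1 m.2) f
    with hD
  have hdecay : ∀ z, (1 + ‖z‖) ^ (2 * n) * ‖f z‖ ≤ D := fun z => by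
    simpa using SchwartzMap.one_add_le_sup_seminorm_apply (𝕜 := ℝ) (m := (2 * n, 0))
      (k := 2 * n) (n := 0) le_rfl le_rfl f z
  have hD0 : 0 ≤ D := le_trans (by positivity) (hdecay 0)
  have hrpow : ∀ {c : ℝ}, 1 ≤ c → ∀ t : ℝ, 0 ≤ t → t ^ (1 / c) ≤ 1 + t := fun {c} hc t ht => by
    calc t ^ (1 / c) ≤ (1 + t) ^ (1 / c) :=
          Real.rpow_le_rpow ht (by linarith) (by positivity)
      _ ≤ (1 + t) ^ (1 : ℝ) := Real.rpow_le_rpow_of_exponent_le (by linarith)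
          ((div_le_one (by linarith)).2 hc)
      _ = 1 + t := Real.rpow_one _
  have hwt : ∀ {c s : ℝ}, 1 ≤ c → 0 ≤ s → ∀ x : EuclideanSpace ℝ (Fin d),
      wt c s x ≤ ENNReal.ofReal (2 ^ s * (1 + ‖x‖) ^ s) := fun {c s} hc hs x => by
    rw [wt, ← Real.mul_rpow (by norm_num) (by positivity)]
    refine ENNReal.ofReal_le_ofReal (Real.rpow_le_rpow (by positivity) ?_ hs)
    linarith [hrpow hc ‖x‖ (norm_nonneg x), norm_nonneg x]
  set g : EuclideanSpace ℝ (Fin d) → ℝ≥0∞ := fun x => ENNReal.ofReal ((1 + ‖x‖) ^ (-(n - k)))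
    with hg
  set g' : EuclideanSpace ℝ (Fin d) → ℝ≥0∞ := fun x => ENNReal.ofReal ((1 + ‖x‖) ^ (-(n - l)))
    with hg'
  have hgm : Measurable g := by fun_prop
  have hgm' : Measurable g' := by fun_prop
  have hle : ∀ x v : EuclideanSpace ℝ (Fin d),
      phaseWt α k l (WithLp.toLp 2 (x, v)) * ‖f (WithLp.toLp 2 (x, v))‖ₑ ≤
        ENNReal.ofReal (2 ^ k * 2 ^ l * D) * (g' v * g x) := fun x v => by
    set z : Phase d := WithLp.toLp 2 (x, v) with hz
    have hx : ‖x‖ ≤ ‖z‖ := WithLp.norm_fst_le _ z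
    have hv : ‖v‖ ≤ ‖z‖ := WithLp.norm_snd_le _ z
    have h1 : ‖f z‖ ≤ D * ((1 + ‖x‖) ^ n)⁻¹ * ((1 + ‖v‖) ^ n)⁻¹ := by
      rw [mul_assoc, ← mul_inv, ← div_eq_mul_inv, le_div_iff₀ (by positivity)]
      refine le_trans ?_ (hdecay z)
      rw [mul_comm, two_mul, pow_add]
      gcongr
    calc phaseWt α k l z * ‖f z‖ₑ
        ≤ (ENNReal.ofReal (2 ^ k * (1 + ‖x‖) ^ k) * ENNReal.ofReal (2 ^ l * (1 + ‖v‖) ^ l)) *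
          ENNReal.ofReal (D * ((1 + ‖x‖) ^ n)⁻¹ * ((1 + ‖v‖) ^ n)⁻¹) := by
          refine mul_le_mul' (mul_le_mul' (hwt (by linarith) hk x) (hwt le_rfl hl v)) ?_
          rw [← ofReal_norm]
          exact ENNReal.ofReal_le_ofReal h1
      _ = ENNReal.ofReal (2 ^ k * 2 ^ l * D) * (g' v * g x) := by
          simp only [hg, hg']
          rw [← ENNReal.ofReal_mul (by positivity), ← ENNReal.ofReal_mul (by positivity),
            ← ENNReal.ofReal_mul (by positivity), ← ENNReal.ofReal_mul (by positivity)]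
          congr 1
          rw [neg_sub, neg_sub, Real.rpow_sub (by positivity), Real.rpow_sub (by positivity),
            Real.rpow_natCast, Real.rpow_natCast]
          field_simp
  have hfin : lpn a volume g < ∞ := lpn_one_add_norm_lt_top ha (by
    rw [← div_lt_iff₀ ha]; linarith)
  have hfin' : lpn b volume g' < ∞ := lpn_one_add_norm_lt_top hb (by
    rw [← div_lt_iff₀ hb]; linarith)
  calc mixn a b (fun z => phaseWt α k l z * ‖f z‖ₑ)
      ≤ lpn b volume fun v => lpn a volume fun x =>
          ENNReal.ofReal (2 ^ k * 2 ^ l * D) * (g' v * g x) :=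
        lpn_mono hb fun v => lpn_mono ha fun x => hle x v
    _ = ENNReal.ofReal (2 ^ k * 2 ^ l * D) * (lpn b volume g' * lpn a volume g) := by
        have e1 : ∀ v, lpn a volume (fun x => ENNReal.ofReal (2 ^ k * 2 ^ l * D) * (g' v * g x)) =
            (ENNReal.ofReal (2 ^ k * 2 ^ l * D) * lpn a volume g) * g' v := fun v => by
          rw [lpn_const_mul ha _ _ (hgm.const_mul _), lpn_const_mul ha _ _ hgm]
          ring
        simp only [e1]
        rw [lpn_const_mul hb _ _ hgm']
        ring
    _ < ∞ := by finiteness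

theorem lpn_phaseWt_le {m : ℕ} (hm : 0 < m) (hk : 0 ≤ k) (hl : 0 ≤ l) (μ : Measure (Phase d))
    [IsProbabilityMeasure μ] (hμ : Integrable (fun z => anorm α z ^ ((k + l) * m)) μ) :
    lpn m μ (phaseWt α k l) ≤ ENNReal.ofReal (2 ^ (k + l) *
      (1 + ∫ z, anorm α z ^ ((k + l) * m) ∂μ) ^ (1 / (m : ℝ))) := by
  have hm0 : (0 : ℝ) < m := by exact_mod_cast hm
  have hnn : ∀ z : Phase d, 0 ≤ anorm α z := fun z => by unfold anorm; positivity
  have hpt : ∀ z : Phase d, phaseWt α k l z ^ (m : ℝ) ≤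
      ENNReal.ofReal (2 ^ ((k + l) * m) * (1 + anorm α z ^ ((k + l) * m))) := fun z => by
    have h1 : phaseWt α k l z ≤ ENNReal.ofReal ((1 + anorm α z) ^ (k + l)) := by
      rw [phaseWt, wt, wt, ← ENNReal.ofReal_mul (by positivity),
        Real.rpow_add (by linarith [hnn z])]
      refine ENNReal.ofReal_le_ofReal ?_
      have : 0 ≤ ‖z.fst‖ ^ (1 / (1 + α)) := by positivity
      unfold anorm
      gcongr ?_ ^ k * ?_ ^ l
      · linarith [norm_nonneg z.snd]
      · rw [div_one, Real.rpow_one]; linarith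
    refine (ENNReal.rpow_le_rpow h1 hm0.le).trans ?_
    rw [ENNReal.ofReal_rpow_of_nonneg (by have := hnn z; positivity) hm0.le,
      ← Real.rpow_mul (by linarith [hnn z])]
    refine ENNReal.ofReal_le_ofReal ?_
    have he : 0 ≤ (k + l) * m := by positivity
    -- 1 + t ≤ 2 max(1, t), the source of the factor 2^{k+l}.
    rcases le_total (anorm α z) 1 with h | h
    · calc (1 + anorm α z) ^ ((k + l) * m) ≤ 2 ^ ((k + l) * m) :=
            Real.rpow_le_rpow (by linarith [hnn z]) (by linarith) he
        _ ≤ _ := le_mul_of_one_le_right (by positivity)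
            (le_add_of_nonneg_right (Real.rpow_nonneg (hnn z) _))
    · calc (1 + anorm α z) ^ ((k + l) * m) ≤ (2 * anorm α z) ^ ((k + l) * m) :=
            Real.rpow_le_rpow (by linarith [hnn z]) (by linarith) he
        _ = 2 ^ ((k + l) * m) * anorm α z ^ ((k + l) * m) := Real.mul_rpow (by norm_num) (hnn z)
        _ ≤ _ := by gcongr; linarith
  have hint : ∫⁻ z, phaseWt α k l z ^ (m : ℝ) ∂μ ≤
      ENNReal.ofReal (2 ^ ((k + l) * m) * (1 + ∫ z, anorm α z ^ ((k + l) * m) ∂μ)) := by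
    refine (lintegral_mono hpt).trans (le_of_eq ?_)
    have hi : Integrable (fun z => (2 : ℝ) ^ ((k + l) * m) * (1 + anorm α z ^ ((k + l) * m))) μ :=
      ((integrable_const 1).add hμ).const_mul _
    rw [← ofReal_integral_eq_lintegral_ofReal hi (.of_forall fun z => mul_nonneg (by positivity)
      (add_nonneg zero_le_one (Real.rpow_nonneg (hnn z) _))), integral_const_mul,
      integral_add (integrable_const 1) hμ]
    simp
  have hI : 0 ≤ ∫ z, anorm α z ^ ((k + l) * m) ∂μ :=
    integral_nonneg fun z => Real.rpow_nonneg (hnn z) _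
  refine (ENNReal.rpow_le_rpow hint (by positivity : 0 ≤ 1 / (m : ℝ))).trans (le_of_eq ?_)
  rw [ENNReal.ofReal_rpow_of_nonneg (by positivity) (by positivity),
    Real.mul_rpow (by positivity) (by positivity), ← Real.rpow_mul (by norm_num), mul_assoc,
    mul_one_div_cancel hm0.ne', mul_one]

end Weight

/-! ### Convolution kernels of the dyadic blocks and their weighted norms -/

section Kernel

variable {d : ℕ}

instance : (volume : Measure (Phase d)).IsNegInvariant :=
  ⟨(LinearIsometryEquiv.neg ℝ (E := Phase d)).measurePreserving.map_eq⟩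

/-- The convolution `z ↦ ∫ g(u) f(z - u) du`. -/
def convFn (g : Phase d → ℂ) (f : Phase d → ℝ) (z : Phase d) : ℂ := ∫ u, g u * (f (z - u) : ℂ)

theorem measurable_convFn {g : Phase d → ℂ} {f : Phase d → ℝ} (hg : Measurable g)
    (hf : Measurable f) : Measurable (convFn g f) := by
  have h : StronglyMeasurable fun z : Phase d × Phase d => g z.2 * (f (z.1 - z.2) : ℂ) := by
    refine Measurable.stronglyMeasurable ?_
    fun_prop
  exact h.integral_prod_right.measurable

theorem norm_convFn_le {g : Phase d → ℂ} {f : Phase d → ℝ} {K : ℝ} (hg : Integrable g)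
    (hK : ∀ z, ‖f z‖ ≤ K) (z : Phase d) : ‖convFn g f z‖ ≤ (∫ u, ‖g u‖) * K := by
  rw [← integral_mul_const]
  refine norm_integral_le_of_norm_le (hg.norm.mul_const K) (.of_forall fun u => ?_)
  rw [norm_mul, Complex.norm_real]
  gcongr
  exact hK _

theorem integrable_mul_conv_and_integral_eq {g : Phase d → ℂ} {f : Phase d → ℝ} {K : ℝ}
    (hg : Integrable g) (hf : Continuous f) (hK : ∀ z, ‖f z‖ ≤ K) (ν : Measure (Phase d))
    [IsFiniteMeasure ν] (z : Phase d) :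
    Integrable (fun u => g u * (conv f ν (z - u) : ℂ)) ∧
      ∫ u, g u * (conv f ν (z - u) : ℂ) = ∫ y, convFn g f (z - y) ∂ν := by
  have hi : Integrable (fun w : Phase d × Phase d => g w.1 * (f (z - w.1 - w.2) : ℂ))
      (volume.prod ν) := by
    refine (hg.comp_fst ν).mul_bdd (c := K) ?_ (.of_forall fun w => ?_)
    · exact (Complex.continuous_ofReal.comp (hf.comp (by fun_prop))).aestronglyMeasurable
    · rw [Complex.norm_real]; exact hK _
  have e : ∀ u, g u * (conv f ν (z - u) : ℂ) = ∫ y, g u * (f (z - u - y) : ℂ) ∂ν := fun u => by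
    rw [integral_const_mul, conv, integral_complex_ofReal]
  simp only [e]
  refine ⟨hi.integral_prod_left, ?_⟩
  rw [integral_integral_swap hi]
  simp only [convFn, sub_right_comm z]

theorem continuous_dilate (α lam : ℝ) (φ : 𝓢(Phase d, ℝ)) : Continuous (dilate α lam φ) := by
  unfold dilate
  refine continuous_const.mul (φ.continuous.comp ?_)
  fun_prop

theorem exists_norm_dilate_le (α lam : ℝ) (φ : 𝓢(Phase d, ℝ)) :
    ∃ K, ∀ z, ‖dilate α lam φ z‖ ≤ K := by
  obtain ⟨K, -, hK⟩ := φ.decay 0 0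
  refine ⟨‖lam ^ ((2 + α) * (d : ℝ))‖ * K, fun z => ?_⟩
  rw [dilate, norm_mul]
  gcongr
  simpa using hK (WithLp.toLp 2 (lam ^ (1 + α) • z.fst, lam • z.snd))

/-- Associativity of convolution, by Fubini: the block acts on φ_λ and the measures are integrated
last, so their difference is tested against one fixed kernel. -/
theorem block_mollifiedDiff {α : ℝ} (χ : Cutoff d α) (j : ℕ) (lam : ℝ) (φ : 𝓢(Phase d, ℝ))
    (ν μ : Measure (Phase d)) [IsFiniteMeasure ν] [IsFiniteMeasure μ] (z : Phase d) :
    χ.block j (mollifiedDiff α lam φ ν μ) z =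
      ∫ y, convFn (invFourier (χ.piece j)) (dilate α lam φ) (z - y) ∂ν -
        ∫ y, convFn (invFourier (χ.piece j)) (dilate α lam φ) (z - y) ∂μ := by
  obtain ⟨K, hK⟩ := exists_norm_dilate_le α lam φ
  set g := invFourier (χ.piece j) with hg
  have hgi : Integrable (g : Phase d → ℂ) := g.integrable
  obtain ⟨hi₁, he₁⟩ := integrable_mul_conv_and_integral_eq hgi (continuous_dilate α lam φ) hK ν z
  obtain ⟨hi₂, he₂⟩ := integrable_mul_conv_and_integral_eq hgi (continuous_dilate α lam φ) hK μ z
  rw [← he₁, ← he₂, ← integral_sub hi₁ hi₂, Cutoff.block, mollifiedDiff,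
    Lp.toTemperedDistribution_apply]
  -- The substitution u ↦ z - u, which relies on reflection invariance of Lebesgue measure.
  refine Eq.trans (integral_congr_ae ?_) (integral_sub_left_eq_self (fun a =>
    g a * (conv (dilate α lam φ) ν (z - a) : ℂ) - g a * (conv (dilate α lam φ) μ (z - a) : ℂ))
    volume z)
  filter_upwards [(((memLp_conv α lam φ ν).sub (memLp_conv α lam φ μ)).ofReal
    (K := ℂ)).coeFn_toLp] with u hu
  refine (congrArg _ hu).trans ?_
  change reflectAt g z u •
    ((conv (dilate α lam φ) ν u - conv (dilate α lam φ) μ u : ℝ) : ℂ) = _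
  simp only [reflectAt, SchwartzMap.compSubConstCLM_apply,
    SchwartzMap.compCLMOfContinuousLinearEquiv_apply, Function.comp_apply,
    ContinuousLinearEquiv.neg_apply, neg_sub, sub_sub_cancel, smul_eq_mul]
  push_cast
  ring

variable {α k l a b : ℝ}

/-- Weighted Young inequality: W(z) ≤ W(u) W(z - u) distributes the weight over both factors, then
Minkowski and translation invariance conclude. -/
theorem mixn_phaseWt_convFn_le (hα : 0 ≤ α) (hk : 0 ≤ k) (hl : 0 ≤ l) (ha : 1 ≤ a) (hb : 1 ≤ b)
    {g : Phase d → ℂ} {f : Phase d → ℝ} (hg : Measurable g) (hf : Measurable f) :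
    mixn a b (fun z => phaseWt α k l z * ‖convFn g f z‖ₑ) ≤
      (∫⁻ u, phaseWt α k l u * ‖g u‖ₑ) * mixn a b fun z => phaseWt α k l z * ‖f z‖ₑ := by
  have ha0 : 0 < a := by linarith
  have hb0 : 0 < b := by linarith
  have hw := measurable_phaseWt (d := d) α k l
  have hwg : Measurable fun u => phaseWt α k l u * ‖g u‖ₑ := hw.mul hg.enorm
  have hwf : Measurable fun z => phaseWt α k l z * ‖f z‖ₑ := hw.mul hf.enorm
  have hFm : Measurable (Function.uncurry fun z u : Phase d =>
      (phaseWt α k l u * ‖g u‖ₑ) * (phaseWt α k l (z - u) * ‖f (z - u)‖ₑ)) :=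
    (hwg.comp measurable_snd).mul (hwf.comp (measurable_fst.sub measurable_snd))
  have hpt : ∀ z, phaseWt α k l z * ‖convFn g f z‖ₑ ≤ lpn 1 volume fun u =>
      (phaseWt α k l u * ‖g u‖ₑ) * (phaseWt α k l (z - u) * ‖f (z - u)‖ₑ) := fun z => by
    rw [lpn_one]
    calc phaseWt α k l z * ‖convFn g f z‖ₑ
        ≤ phaseWt α k l z * ∫⁻ u, ‖g u * (f (z - u) : ℂ)‖ₑ := by
          gcongr
          exact enorm_integral_le_lintegral_enorm _
      _ = ∫⁻ u, phaseWt α k l z * ‖g u * (f (z - u) : ℂ)‖ₑ :=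
          (lintegral_const_mul _ (by fun_prop)).symm
      _ ≤ _ := by
          refine lintegral_mono fun u => ?_
          have h1 : phaseWt α k l z ≤ phaseWt α k l u * phaseWt α k l (z - u) := by
            simpa using phaseWt_add_le hα hk hl u (z - u)
          have h2 : ‖(f (z - u) : ℂ)‖ₑ = ‖f (z - u)‖ₑ := by
            rw [← ofReal_norm, ← ofReal_norm, Complex.norm_real]
          rw [enorm_mul, h2]
          refine (mul_le_mul_left h1 _).trans (le_of_eq ?_)
          ring
  calc mixn a b (fun z => phaseWt α k l z * ‖convFn g f z‖ₑ)
      ≤ mixn a b fun z => lpn 1 volume fun u =>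
          (phaseWt α k l u * ‖g u‖ₑ) * (phaseWt α k l (z - u) * ‖f (z - u)‖ₑ) :=
        mixn_mono ha0 hb0 hpt
    _ ≤ lpn 1 volume fun u => mixn a b fun z =>
          (phaseWt α k l u * ‖g u‖ₑ) * (phaseWt α k l (z - u) * ‖f (z - u)‖ₑ) :=
        mixn_lpn_le one_pos ha hb volume hFm
    _ = ∫⁻ u, (phaseWt α k l u * ‖g u‖ₑ) * mixn a b fun z => phaseWt α k l z * ‖f z‖ₑ := by
        rw [lpn_one]
        refine lintegral_congr fun u => ?_
        have hm : Measurable fun z => phaseWt α k l (z - u) * ‖f (z - u)‖ₑ :=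
          hwf.comp (measurable_id.sub_const u)
        rw [mixn_const_mul ha0 hb0 _ hm, mixn_translate (fun z => phaseWt α k l z * ‖f z‖ₑ)]
    _ = _ := lintegral_mul_const _ hwg

/-- As λ ≥ 1, the weight may be evaluated at the dilated point instead; the exact scaling of the
norm then gives (2+α)d - (1+α)d/a - d/b as the power of λ. -/
theorem mixn_phaseWt_dilate_le (hα : 0 ≤ α) (hk : 0 ≤ k) (hl : 0 ≤ l) (ha : 0 < a) (hb : 0 < b)
    (φ : 𝓢(Phase d, ℝ)) {lam : ℝ} (hlam : 1 ≤ lam) :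
    mixn a b (fun z => phaseWt α k l z * ‖dilate α lam φ z‖ₑ) ≤
      ENNReal.ofReal (lam ^ ((1 + α) * d * (1 - 1 / a) + d * (1 - 1 / b))) *
        mixn a b fun z => phaseWt α k l z * ‖φ z‖ₑ := by
  have hl0 : 0 < lam := by linarith
  have hF : Measurable fun z => phaseWt α k l z * ‖φ z‖ₑ :=
    (measurable_phaseWt α k l).mul φ.continuous.measurable.enorm
  have hs : (1 : ℝ) ≤ lam ^ (1 + α) := Real.one_le_rpow hlam (by linarith)
  have hsc := mixn_comp_scale ha hb (s := lam ^ (1 + α)) (t := lam) (by positivity) hl0 hF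
  have hm : Measurable fun z : Phase d => (WithLp.toLp 2 (lam ^ (1 + α) • z.fst, lam • z.snd) :
      Phase d) := Continuous.measurable (by fun_prop)
  calc mixn a b (fun z => phaseWt α k l z * ‖dilate α lam φ z‖ₑ)
      ≤ mixn a b (fun z => ENNReal.ofReal (lam ^ ((2 + α) * d)) *
          (phaseWt α k l (WithLp.toLp 2 (lam ^ (1 + α) • z.fst, lam • z.snd)) *
            ‖φ (WithLp.toLp 2 (lam ^ (1 + α) • z.fst, lam • z.snd))‖ₑ)) := by
        refine mixn_mono ha hb fun z => ?_
        rw [dilate, enorm_mul, Real.enorm_of_nonneg (by positivity), mul_left_comm]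
        gcongr
        exact phaseWt_le_scale hα hk hl hs hlam z
    _ = ENNReal.ofReal (lam ^ ((2 + α) * d)) *
          (ENNReal.ofReal ((lam ^ (1 + α)) ^ (-(d / a)) * lam ^ (-(d / b))) *
            mixn a b fun z => phaseWt α k l z * ‖φ z‖ₑ) := by
        rw [← hsc]
        exact mixn_const_mul ha hb _ (hF.comp hm)
    _ = _ := by
        rw [← mul_assoc, ← ENNReal.ofReal_mul (by positivity), ← Real.rpow_mul hl0.le,
          ← Real.rpow_add hl0, ← Real.rpow_add hl0]
        congr 3
        ring

theorem invFourier_sub (f g : 𝓢(Phase d, ℝ)) :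
    invFourier (f - g) = invFourier f - invFourier g := by
  simp only [invFourier, map_sub]
  exact map_sub (FourierTransform.fourierInvCLM ℂ 𝓢(Phase d, ℂ)) _ _

theorem inner_scaleBy {s t : ℝ} (hs : s ≠ 0) (ht : t ≠ 0) (z w : Phase d) :
    inner ℝ (scaleBy d s t hs ht z) w = inner ℝ z (scaleBy d s t hs ht w) := by
  simp only [WithLp.prod_inner_apply]
  change inner ℝ (s • z.fst) w.fst + inner ℝ (t • z.snd) w.snd =
    inner ℝ z.fst (s • w.fst) + inner ℝ z.snd (t • w.snd)
  simp only [real_inner_smul_left, real_inner_smul_right]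

/-- Contracting the frequency variable by S turns ǧ into |det S|⁻¹ ǧ(S⁻¹ ·), which has the same L¹
norm and is more concentrated; S⁻¹ expands, so W(z) ≤ W(S⁻¹ z). -/
theorem lintegral_phaseWt_invFourier_comp_le (hα : 0 ≤ α) (hk : 0 ≤ k) (hl : 0 ≤ l) {s t : ℝ}
    (hs : 0 < s) (ht : 0 < t) (hs1 : s ≤ 1) (ht1 : t ≤ 1) (g : 𝓢(Phase d, ℝ)) :
    ∫⁻ z, phaseWt α k l z * ‖invFourier (SchwartzMap.compCLMOfContinuousLinearEquiv ℝ
        (scaleBy d s t hs.ne' ht.ne') g) z‖ₑ ≤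
      ∫⁻ z, phaseWt α k l z * ‖invFourier g z‖ₑ := by
  set S := scaleBy d s t hs.ne' ht.ne' with hS
  have hdet : LinearMap.det (S.toLinearEquiv : Phase d →ₗ[ℝ] Phase d) ≠ 0 :=
    S.toLinearEquiv.isUnit_det'.ne_zero
  set D : ℝ := |(LinearMap.det (S.toLinearEquiv : Phase d →ₗ[ℝ] Phase d))⁻¹| with hD
  have hD0 : 0 < D := abs_pos.2 (inv_ne_zero hdet)
  have hmap : Measure.map S (volume : Measure (Phase d)) = ENNReal.ofReal D • volume :=
    Measure.map_linearMap_addHaar_eq_smul_addHaar volume hdet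
  have hSm : MeasurableEmbedding S := S.toHomeomorph.measurableEmbedding
  have hinv : ∀ z, invFourier (SchwartzMap.compCLMOfContinuousLinearEquiv ℝ S g) z =
      (D : ℂ) * invFourier g (S.symm z) := fun z => by
    rw [invFourier_apply, invFourier_apply]
    have h1 : ∀ ξ, (inner ℝ ξ z : ℝ) = inner ℝ (S ξ) (S.symm z) := fun ξ => by
      rw [hS, inner_scaleBy, ContinuousLinearEquiv.apply_symm_apply]
    have h2 := hSm.integral_map (μ := volume) (fun ξ =>
      Complex.exp (Complex.I * (inner ℝ ξ (S.symm z) : ℝ)) * (g ξ : ℂ))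
    rw [hmap, integral_smul_measure, ENNReal.toReal_ofReal hD0.le] at h2
    simp only [SchwartzMap.compCLMOfContinuousLinearEquiv_apply, Function.comp_apply, h1]
    rw [← h2, smul_comm, Complex.real_smul (x := D)]
  have hw : ∀ z, phaseWt α k l z ≤ phaseWt α k l (S.symm z) := fun z =>
    phaseWt_le_scale hα hk hl ((one_le_inv₀ hs).2 hs1) ((one_le_inv₀ ht).2 ht1) z
  have hGm : Measurable fun z => phaseWt α k l z * ‖invFourier g z‖ₑ :=
    (measurable_phaseWt α k l).mul (invFourier g).continuous.measurable.enorm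
  have hI : ENNReal.ofReal D * ∫⁻ z, phaseWt α k l (S.symm z) * ‖invFourier g (S.symm z)‖ₑ =
      ∫⁻ z, phaseWt α k l z * ‖invFourier g z‖ₑ := by
    rw [← smul_eq_mul, ← lintegral_smul_measure, ← hmap, hSm.lintegral_map]
    simp
  have hGS : Measurable fun z => phaseWt α k l (S.symm z) * ‖invFourier g (S.symm z)‖ₑ :=
    hGm.comp S.symm.continuous.measurable
  rw [← hI, ← lintegral_const_mul _ hGS]
  refine lintegral_mono fun z => ?_
  rw [hinv, enorm_mul, ← ofReal_norm, Complex.norm_real, Real.norm_of_nonneg hD0.le, mul_left_comm]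
  gcongr
  exact hw z

/-- The source of uniformity in j: each piece is the cut-off or a difference of two contracted
copies of it, whence the factor 2. -/
theorem lintegral_phaseWt_invFourier_piece_le (hα : 0 ≤ α) (hk : 0 ≤ k) (hl : 0 ≤ l)
    (χ : Cutoff d α) (j : ℕ) :
    ∫⁻ z, phaseWt α k l z * ‖invFourier (χ.piece j) z‖ₑ ≤
      2 * ∫⁻ z, phaseWt α k l z * ‖invFourier χ.fn z‖ₑ := by
  have key : ∀ i : ℕ, ∫⁻ z, phaseWt α k l z *
      ‖invFourier (SchwartzMap.compCLMOfContinuousLinearEquiv ℝ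
        (dyadicScale d α (-(i : ℝ))) χ.fn) z‖ₑ ≤ ∫⁻ z, phaseWt α k l z * ‖invFourier χ.fn z‖ₑ :=
    fun i => lintegral_phaseWt_invFourier_comp_le hα hk hl (by positivity) (by positivity)
      (Real.rpow_le_one_of_one_le_of_nonpos (by norm_num)
        (mul_nonpos_of_nonneg_of_nonpos (by linarith) (by simp)))
      (Real.rpow_le_one_of_one_le_of_nonpos (by norm_num) (by simp)) χ.fn
  cases j with
  | zero => exact le_mul_of_one_le_left zero_le (by norm_num)
  | succ i =>
    have h1 := key (i + 1)
    push_cast at h1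
    rw [two_mul]
    refine le_trans ?_ (add_le_add h1 (key i))
    rw [← lintegral_add_left]
    · refine lintegral_mono fun z => ?_
      rw [Cutoff.piece, invFourier_sub, ← mul_add]
      gcongr
      exact enorm_sub_le
    · exact (measurable_phaseWt α k l).mul (SchwartzMap.continuous _).measurable.enorm

end Kernel

/-! ### Symmetrization and the type-q inequality -/

section Symmetrization

variable {X Y : Type*} [MeasurableSpace X] [MeasurableSpace Y]

theorem lpn_comp {p : ℝ} {μ : Measure X} {ν : Measure Y} {T : X → Y} (hT : MeasurePreserving T μ ν)
    {f : Y → ℝ≥0∞} (hf : Measurable f) : lpn p μ (fun x => f (T x)) = lpn p ν f := by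
  rw [lpn, lpn, hT.lintegral_comp (hf.pow_const p)]

theorem lpn_prod {p : ℝ} (hp : 0 < p) (μ : Measure X) (ν : Measure Y) [SFinite ν]
    {f : X × Y → ℝ≥0∞} (hf : Measurable f) :
    lpn p (μ.prod ν) f = lpn p μ fun x => lpn p ν fun y => f (x, y) := by
  rw [lpn, lintegral_prod _ (hf.pow_const p).aemeasurable, lpn]
  simp only [lpn_rpow hp]

variable {d N : ℕ} {a b q : ℝ} {m : ℕ} {W : Phase d → ℝ≥0∞} {H : Phase d → ℂ}

theorem measurable_weighted_sum (hW : Measurable W) (hH : Measurable H)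
    (c : Fin N → Y → ℝ) (hc : ∀ i, Measurable (c i)) (u v : Fin N → Y → Phase d)
    (hu : ∀ i, Measurable (u i)) (hv : ∀ i, Measurable (v i)) :
    Measurable (Function.uncurry fun (z : Phase d) (y : Y) =>
      W z * ‖∑ i, (c i y : ℂ) * (H (z - u i y) - H (z - v i y))‖ₑ) := by
  refine (hW.comp measurable_fst).mul (Measurable.enorm ?_)
  refine Finset.measurable_sum _ fun i _ => ?_
  fun_prop

/-- The mean is the expectation over an independent copy of the sample, so the norm moves inside
that expectation, and L¹ ≤ L^m over the copy. -/
theorem lpn_centered_sum_le_symmetrized (ha : 1 ≤ a) (hb : 1 ≤ b) (hm : 1 ≤ m)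
    (hW : Measurable W) (hH : Measurable H) {B : ℝ} (hB : ∀ z, ‖H z‖ ≤ B) (μ : Measure (Phase d))
    [IsProbabilityMeasure μ] :
    lpn m (Measure.pi fun _ : Fin N => μ) (fun x => mixn a b fun z =>
        W z * ‖∑ i, (H (z - x i) - ∫ y, H (z - y) ∂μ)‖ₑ) ≤
      lpn m (Measure.pi fun _ : Fin N => μ.prod μ) (fun w => mixn a b fun z =>
        W z * ‖∑ i, (H (z - (w i).1) - H (z - (w i).2))‖ₑ) := by
  have hm0 : (0 : ℝ) < m := by exact_mod_cast hm
  have hm1 : (1 : ℝ) ≤ m := by exact_mod_cast hm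
  set ν := Measure.pi fun _ : Fin N => μ with hν
  set G : (Fin N → Phase d) × (Fin N → Phase d) → ℝ≥0∞ := fun w => mixn a b fun z =>
    W z * ‖∑ i, (H (z - w.1 i) - H (z - w.2 i))‖ₑ with hG
  have hGm : Measurable G := by
    have := measurable_weighted_sum hW hH
      (fun _ (_ : (Fin N → Phase d) × (Fin N → Phase d)) => 1) (fun _ => measurable_const)
      (fun i w => w.1 i) (fun i w => w.2 i) (fun i => by fun_prop) (fun i => by fun_prop)
    simpa only [Complex.ofReal_one, one_mul] using measurable_mixn this a b
  have hHi : ∀ z, Integrable (fun y => H (z - y)) μ := fun z =>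
    Integrable.of_bound (hH.comp (measurable_const.sub measurable_id)).aestronglyMeasurable B
      (.of_forall fun _ => hB _)
  have hpt : ∀ x, mixn a b (fun z => W z * ‖∑ i, (H (z - x i) - ∫ y, H (z - y) ∂μ)‖ₑ) ≤
      lpn m ν fun y => G (x, y) := fun x => by
    have hFm : Measurable (Function.uncurry fun (z : Phase d) (y : Fin N → Phase d) =>
        W z * ‖∑ i, (H (z - x i) - H (z - y i))‖ₑ) := by
      simpa only [Complex.ofReal_one, one_mul] using measurable_weighted_sum hW hH
        (fun _ (_ : Fin N → Phase d) => 1) (fun _ => measurable_const)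
        (fun i _ => x i) (fun i y => y i) (fun i => by fun_prop) (fun i => by fun_prop)
    have hz : ∀ z, W z * ‖∑ i, (H (z - x i) - ∫ y, H (z - y) ∂μ)‖ₑ ≤
        lpn 1 ν fun y => W z * ‖∑ i, (H (z - x i) - H (z - y i))‖ₑ := fun z => by
      have hmp : ∀ i, MeasurePreserving (Function.eval i) ν μ :=
        fun i => measurePreserving_eval (fun _ : Fin N => μ) i
      have hint : ∀ i, Integrable (fun y : Fin N → Phase d => H (z - x i) - H (z - y i)) ν :=
        fun i => (integrable_const _).sub ((hmp i).integrable_comp_of_integrable (hHi z))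
      have he : ∑ i, (H (z - x i) - ∫ y, H (z - y) ∂μ) =
          ∫ y, ∑ i, (H (z - x i) - H (z - y i)) ∂ν := by
        rw [integral_finsetSum _ fun i _ => hint i]
        refine Finset.sum_congr rfl fun i _ => ?_
        have hi : Integrable (fun y : Fin N → Phase d => H (z - y i)) ν :=
          (hmp i).integrable_comp_of_integrable (hHi z)
        rw [integral_sub (integrable_const _) hi, integral_const, probReal_univ, one_smul,
          ← (hmp i).map_eq, integral_map (hmp i).measurable.aemeasurable]
        rw [(hmp i).map_eq]
        exact (hHi z).aestronglyMeasurable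
      rw [he, lpn_one, lintegral_const_mul]
      · gcongr
        exact enorm_integral_le_lintegral_enorm _
      · refine Measurable.enorm (Finset.measurable_sum _ fun i _ => ?_)
        fun_prop
    calc _ ≤ _ := mixn_mono (by linarith) (by linarith) hz
      _ ≤ lpn 1 ν fun y => G (x, y) := mixn_lpn_le one_pos ha hb ν hFm
      _ ≤ lpn m ν fun y => G (x, y) :=
        lpn_mono_exponent one_pos hm1 ν (hGm.comp measurable_prodMk_left)
  calc _ ≤ lpn m ν fun x => lpn m ν fun y => G (x, y) := lpn_mono hm0 hpt
    _ = lpn m (ν.prod ν) G := (lpn_prod hm0 ν ν hGm).symm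
    _ = _ := (lpn_comp (measurePreserving_arrowProdEquivProdArrow (Phase d) (Phase d) (Fin N)
        (fun _ => μ) (fun _ => μ)) hGm).symm

/-- A negative sign swaps the two points of the i-th pair, and the law of the pairs is invariant
under such swaps. -/
theorem lpn_signed_sum_eq (hW : Measurable W) (hH : Measurable H) (μ : Measure (Phase d))
    [IsProbabilityMeasure μ] (ε : Fin N → Bool) :
    lpn m (Measure.pi fun _ : Fin N => μ.prod μ) (fun w => mixn a b fun z =>
        W z * ‖∑ i, (sgn (ε i) : ℂ) * (H (z - (w i).1) - H (z - (w i).2))‖ₑ) =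
      lpn m (Measure.pi fun _ : Fin N => μ.prod μ) (fun w => mixn a b fun z =>
        W z * ‖∑ i, (H (z - (w i).1) - H (z - (w i).2))‖ₑ) := by
  have hT : MeasurePreserving
      (fun (w : Fin N → Phase d × Phase d) i => (if ε i then id else Prod.swap) (w i))
      (Measure.pi fun _ => μ.prod μ) (Measure.pi fun _ => μ.prod μ) := by
    refine measurePreserving_pi _ _ fun i => ?_
    cases ε i
    · exact Measure.measurePreserving_swap
    · exact MeasurePreserving.id _
  have hGm := measurable_weighted_sum hW hH
      (fun _ (_ : Fin N → Phase d × Phase d) => 1) (fun _ => measurable_const)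
      (fun i w => (w i).1) (fun i w => (w i).2) (fun i => by fun_prop) (fun i => by fun_prop)
  simp only [Complex.ofReal_one, one_mul] at hGm
  rw [← lpn_comp hT (measurable_mixn hGm a b)]
  congr 1
  funext w
  congr 1
  funext z
  congr 3
  funext i
  cases h : ε i <;> simp [sgn, h]

/-- Khintchine's inequality in a weighted mixed Lebesgue space. -/
theorem lpn_signs_mixn_le {M : ℕ} {K : ℝ≥0∞} (ha : 0 < a) (hb : 0 < b) (hm : 0 < m)
    (hmM : (m : ℝ) ≤ M) (haM : a ≤ M) (hbM : b ≤ M) (hq : 0 < q) (hqa : q ≤ a) (hqb : q ≤ b)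
    (hK : ∀ c : Fin N → ℂ, lpn M (signs N) (fun ε => ‖∑ i, (sgn (ε i) : ℂ) * c i‖ₑ) ≤
      K * lpn q Measure.count (fun i => ‖c i‖ₑ))
    (hW : Measurable W) (D : Fin N → Phase d → ℂ) (hD : ∀ i, Measurable (D i)) :
    lpn m (signs N) (fun ε => mixn a b fun z => W z * ‖∑ i, (sgn (ε i) : ℂ) * D i z‖ₑ) ≤
      K * lpn q Measure.count fun i => mixn a b fun z => W z * ‖D i z‖ₑ := by
  have hm0 : (0 : ℝ) < m := by exact_mod_cast hm
  have hFm : Measurable (Function.uncurry fun (z : Phase d) (ε : Fin N → Bool) =>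
      W z * ‖∑ i, (sgn (ε i) : ℂ) * D i z‖ₑ) := by
    refine measurable_from_prod_countable_left fun ε => hW.mul (Measurable.enorm ?_)
    exact Finset.measurable_sum _ fun i _ => (hD i).const_mul (sgn (ε i) : ℂ)
  have hGm : Measurable (Function.uncurry fun (z : Phase d) (i : Fin N) => W z * ‖D i z‖ₑ) :=
    measurable_from_prod_countable_left fun i => hW.mul (hD i).enorm
  calc _ ≤ lpn M (signs N) (fun ε => mixn a b fun z =>
          W z * ‖∑ i, (sgn (ε i) : ℂ) * D i z‖ₑ) :=
        lpn_mono_exponent hm0 hmM _ (measurable_of_finite _)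
    _ ≤ mixn a b fun z => lpn M (signs N) fun ε =>
          W z * ‖∑ i, (sgn (ε i) : ℂ) * D i z‖ₑ := lpn_mixn_le ha hb haM hbM _ hFm
    _ ≤ mixn a b fun z => K * lpn q Measure.count fun i => W z * ‖D i z‖ₑ := by
        refine mixn_mono ha hb fun z => ?_
        rw [lpn_const_mul (hm0.trans_le hmM) _ _ (measurable_of_finite _),
          lpn_const_mul hq _ _ (measurable_of_finite _), mul_left_comm]
        gcongr
        exact hK fun i => D i z
    _ = K * mixn a b fun z => lpn q Measure.count fun i => W z * ‖D i z‖ₑ :=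
        mixn_const_mul ha hb _ (measurable_lpn' _ hGm)
    _ ≤ _ := by
        gcongr
        exact mixn_lpn_le hq hqa hqb _ hGm

/-- The type-`q` inequality for i.i.d. sums of translates in weighted mixed Lebesgue spaces. -/
theorem exists_lpn_centered_sum_le (ha : 1 ≤ a) (hb : 1 ≤ b) (hm : 1 ≤ m) (hq : 0 < q)
    (hq2 : q ≤ 2) (hqa : q ≤ a) (hqb : q ≤ b) (hqm : q ≤ m) : ∃ K : ℝ≥0∞, K ≠ ∞ ∧
    ∀ (W : Phase d → ℝ≥0∞), Measurable W → (∀ z w, W (z + w) ≤ W z * W w) →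
    ∀ (H : Phase d → ℂ), Measurable H → ∀ (B : ℝ), (∀ z, ‖H z‖ ≤ B) →
    ∀ (μ : Measure (Phase d)) [IsProbabilityMeasure μ] (N : ℕ),
      lpn m (Measure.pi fun _ : Fin N => μ) (fun x => mixn a b fun z =>
        W z * ‖∑ i, (H (z - x i) - ∫ y, H (z - y) ∂μ)‖ₑ) ≤
      K * (N : ℝ≥0∞) ^ (1 / q) * lpn m μ W * mixn a b fun z => W z * ‖H z‖ₑ := by
  have ha0 : 0 < a := by linarith
  have hb0 : 0 < b := by linarith
  have hm0 : (0 : ℝ) < m := by exact_mod_cast hm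
  have hm1 : (1 : ℝ) ≤ m := by exact_mod_cast hm
  -- Khintchine is used at an integer exponent M above m, a and b, so that the norm over the signs
  -- can enter the mixed norm.
  obtain ⟨M, hM⟩ := exists_nat_ge (max (m : ℝ) (max a b))
  have hmM : (m : ℝ) ≤ M := (le_max_left _ _).trans hM
  have haM : a ≤ M := ((le_max_left _ _).trans (le_max_right _ _)).trans hM
  have hbM : b ≤ M := ((le_max_right _ _).trans (le_max_right _ _)).trans hM
  obtain ⟨K, hK, hKh⟩ := exists_khintchine (M := M) (by exact_mod_cast hm0.trans_le hmM)
  refine ⟨2 * K, by finiteness, fun W hW hWsub H hH B hB μ _ N => ?_⟩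
  set ν := Measure.pi fun _ : Fin N => μ.prod μ with hν
  set R := mixn a b fun z => W z * ‖H z‖ₑ with hR
  set D : Phase d × Phase d → Phase d → ℂ := fun w z => H (z - w.1) - H (z - w.2) with hD
  have hWH : Measurable fun z => W z * ‖H z‖ₑ := hW.mul hH.enorm
  have hDm : Measurable (Function.uncurry fun (z : Phase d) (w : Phase d × Phase d) =>
      W z * ‖D w z‖ₑ) := by
    refine (hW.comp measurable_fst).mul (Measurable.enorm ?_)
    fun_prop
  have hDm' : Measurable (Function.uncurry fun (z : Phase d)
      (y : (Fin N → Phase d × Phase d) × Fin N) => W z * ‖D (y.1 y.2) z‖ₑ) := by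
    have he : Measurable fun y : (Fin N → Phase d × Phase d) × Fin N => y.1 y.2 :=
      measurable_from_prod_countable_left fun i => measurable_pi_apply i
    exact hDm.comp (measurable_fst.prodMk (he.comp measurable_snd))
  have htrans : ∀ u, mixn a b (fun z => W z * ‖H (z - u)‖ₑ) ≤ W u * R := fun u => by
    have hmeas : Measurable fun z => W (z - u) * ‖H (z - u)‖ₑ :=
      hWH.comp (measurable_id.sub_const u)
    rw [hR, ← mixn_translate (fun z => W z * ‖H z‖ₑ) u, ← mixn_const_mul ha0 hb0 _ hmeas]
    refine mixn_mono ha0 hb0 fun z => ?_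
    rw [← mul_assoc]
    gcongr
    simpa using hWsub u (z - u)
  have hpair : ∀ w : Phase d × Phase d, mixn a b (fun z => W z * ‖D w z‖ₑ) ≤
      R * (W w.1 + W w.2) := fun w => by
    calc mixn a b (fun z => W z * ‖D w z‖ₑ)
        ≤ mixn a b (fun z => W z * ‖H (z - w.1)‖ₑ + W z * ‖H (z - w.2)‖ₑ) := by
          refine mixn_mono ha0 hb0 fun z => ?_
          rw [← mul_add]
          gcongr
          exact enorm_sub_le
      _ ≤ _ := mixn_add_le ha hb (by fun_prop) (by fun_prop)
      _ ≤ W w.1 * R + W w.2 * R := add_le_add (htrans _) (htrans _)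
      _ = _ := by ring
  have hterm : ∀ i, lpn m ν (fun w => mixn a b fun z => W z * ‖D (w i) z‖ₑ) ≤
      2 * lpn m μ W * R := fun i => by
    have hmp : MeasurePreserving (Function.eval i) ν (μ.prod μ) :=
      measurePreserving_eval (fun _ : Fin N => μ.prod μ) i
    have h1 : lpn m ν (fun w => W (w i).1) = lpn m μ W :=
      lpn_comp (measurePreserving_fst.comp hmp) hW
    have h2 : lpn m ν (fun w => W (w i).2) = lpn m μ W :=
      lpn_comp (measurePreserving_snd.comp hmp) hW
    have hm1' : Measurable fun w : Fin N → Phase d × Phase d => W (w i).1 := by fun_prop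
    have hm2' : Measurable fun w : Fin N → Phase d × Phase d => W (w i).2 := by fun_prop
    calc _ ≤ lpn m ν (fun w => R * (W (w i).1 + W (w i).2)) := lpn_mono hm0 fun w => hpair (w i)
      _ = R * lpn m ν (fun w => W (w i).1 + W (w i).2) :=
        lpn_const_mul hm0 _ _ (hm1'.add hm2')
      _ ≤ R * (lpn m μ W + lpn m μ W) := by
        gcongr
        exact (lpn_add_le hm1 hm1' hm2').trans (by rw [h1, h2])
      _ = _ := by ring
  have hcond : ∀ w : Fin N → Phase d × Phase d, lpn m (signs N) (fun ε => mixn a b fun z =>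
      W z * ‖∑ i, (sgn (ε i) : ℂ) * D (w i) z‖ₑ) ≤
        K * lpn q Measure.count fun i => mixn a b fun z => W z * ‖D (w i) z‖ₑ := fun w => by
    refine lpn_signs_mixn_le ha0 hb0 hm hmM haM hbM hq hqa hqb (hKh q hq hq2 N) hW _ fun i => ?_
    fun_prop
  have hjoint : Measurable (Function.uncurry fun (ε : Fin N → Bool)
      (w : Fin N → Phase d × Phase d) => mixn a b fun z =>
        W z * ‖∑ i, (sgn (ε i) : ℂ) * D (w i) z‖ₑ) :=
    measurable_mixn (measurable_weighted_sum hW hH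
      (fun i (y : (Fin N → Bool) × (Fin N → Phase d × Phase d)) => sgn (y.1 i))
      (fun i => (measurable_of_finite fun ε : Fin N → Bool => sgn (ε i)).comp measurable_fst)
      (fun i y => (y.2 i).1) (fun i y => (y.2 i).2) (fun i => by fun_prop)
      (fun i => by fun_prop)) a b
  calc _ ≤ lpn m ν (fun w => mixn a b fun z => W z * ‖∑ i, D (w i) z‖ₑ) :=
        lpn_centered_sum_le_symmetrized ha hb hm hW hH hB μ
    _ = lpn m (signs N) fun ε => lpn m ν fun w => mixn a b fun z =>
          W z * ‖∑ i, (sgn (ε i) : ℂ) * D (w i) z‖ₑ := by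
        -- The norm is the same for every choice of signs, hence equal to its L^m average over them.
        simp only [hD, hν, lpn_signed_sum_eq hW hH μ]
        rw [lpn_const hm0]
    _ ≤ lpn m ν fun w => lpn m (signs N) fun ε => mixn a b fun z =>
          W z * ‖∑ i, (sgn (ε i) : ℂ) * D (w i) z‖ₑ := lpn_lpn_le hm0 le_rfl _ _ hjoint
    _ ≤ lpn m ν fun w => K * lpn q Measure.count fun i => mixn a b fun z => W z * ‖D (w i) z‖ₑ :=
        lpn_mono hm0 hcond
    _ = K * lpn m ν fun w => lpn q Measure.count fun i => mixn a b fun z => W z * ‖D (w i) z‖ₑ :=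
        lpn_const_mul hm0 _ _ (measurable_lpn' _ (measurable_mixn hDm' a b))
    _ ≤ K * lpn q Measure.count fun i => lpn m ν fun w => mixn a b fun z => W z * ‖D (w i) z‖ₑ := by
        gcongr
        -- The ℓ^q sum leaves the L^m norm because q ≤ m.
        exact lpn_lpn_le hq hqm _ _ (measurable_mixn hDm' a b)
    _ ≤ K * lpn q Measure.count fun _ : Fin N => 2 * lpn m μ W * R := by
        gcongr
        exact lpn_mono hq hterm
    _ = _ := by
        have : lpn q Measure.count (fun _ : Fin N => 2 * lpn m μ W * R) =
            (N : ℝ≥0∞) ^ (1 / q) * (2 * lpn m μ W * R) := by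
          rw [lpn, lintegral_const, Measure.count_univ, ENat.card_eq_coe_fintype_card,
            Fintype.card_fin, ENNReal.mul_rpow_of_nonneg _ _ (by positivity), ← ENNReal.rpow_mul,
            mul_one_div_cancel hq.ne', ENNReal.rpow_one, mul_comm]
          simp
        rw [this]
        ring

end Symmetrization

/-! ### Empirical measures and the bound for one block -/

section Empirical

variable {d N : ℕ}

theorem integral_empirical {f : Phase d → ℂ} (hf : Measurable f) {B : ℝ} (hB : ∀ z, ‖f z‖ ≤ B)
    (x : Fin N → Phase d) : ∫ y, f y ∂empirical x = (N : ℂ)⁻¹ * ∑ i, f (x i) := by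
  rw [empirical, integral_smul_nnreal_measure, integral_finsetSum_measure]
  · simp only [integral_dirac]
    rw [NNReal.smul_def, Complex.real_smul]
    simp
  · exact fun i _ => Integrable.of_bound hf.aestronglyMeasurable B (.of_forall hB)

/-- This exhibits the block as a normalized sum of centered translates, the form that the type-q
inequality handles. -/
theorem block_empirical {α : ℝ} (χ : Cutoff d α) (j : ℕ) (lam : ℝ) (φ : 𝓢(Phase d, ℝ))
    (hN : 1 ≤ N) (x : Fin N → Phase d) (μ : Measure (Phase d)) [IsProbabilityMeasure μ]
    (z : Phase d) :
    χ.block j (mollifiedDiff α lam φ (empirical x) μ) z = (N : ℂ)⁻¹ * ∑ i,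
      (convFn (invFourier (χ.piece j)) (dilate α lam φ) (z - x i) -
        ∫ y, convFn (invFourier (χ.piece j)) (dilate α lam φ) (z - y) ∂μ) := by
  obtain ⟨K, hK⟩ := exists_norm_dilate_le α lam φ
  have hm : Measurable (convFn (invFourier (χ.piece j)) (dilate α lam φ)) :=
    measurable_convFn (SchwartzMap.continuous _).measurable (continuous_dilate α lam φ).measurable
  have hN0 : (N : ℂ) ≠ 0 := by exact_mod_cast (by omega : N ≠ 0)
  have hmz : Measurable fun y => convFn (invFourier (χ.piece j)) (dilate α lam φ) (z - y) :=
    hm.comp (measurable_const.sub measurable_id)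
  rw [block_mollifiedDiff, integral_empirical hmz
    (fun _ => norm_convFn_le (SchwartzMap.integrable _) hK _), Finset.sum_sub_distrib,
    Finset.sum_const, Finset.card_univ, Fintype.card_fin, nsmul_eq_mul, mul_sub,
    inv_mul_cancel_left₀ hN0]

theorem besovNorm_one_eq_tsum {α : ℝ} (χ : Cutoff d α) (s : ℝ) (p : ℝ≥0∞ × ℝ≥0∞)
    (f : 𝓢'(Phase d, ℂ)) : χ.besovNorm s 1 p f =
      ∑' j : ℕ, ENNReal.ofReal ((2 : ℝ) ^ ((j : ℝ) * s)) * mixedNorm p (χ.block j f) := by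
  rw [Cutoff.besovNorm, eLpNorm_one_eq_lintegral_enorm, lintegral_count]
  simp only [enorm_eq_self]

theorem tsum_ofReal_two_rpow_ne_top {β : ℝ} (hβ : β < 0) :
    ∑' j : ℕ, ENNReal.ofReal ((2 : ℝ) ^ ((j : ℝ) * β)) ≠ ∞ := by
  have h : ∀ j : ℕ, ENNReal.ofReal ((2 : ℝ) ^ ((j : ℝ) * β)) = ENNReal.ofReal (2 ^ β) ^ j :=
    fun j => by
      rw [← ENNReal.ofReal_pow (by positivity), ← Real.rpow_mul_natCast (by norm_num), mul_comm]
  simp only [h]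
  rw [ENNReal.tsum_geometric, ENNReal.inv_ne_top]
  refine (tsub_pos_of_lt ?_).ne'
  rw [ENNReal.ofReal_lt_one]
  exact Real.rpow_lt_one_of_one_lt_of_neg (by norm_num) hβ

/-- Splitting the moment exponent between position and velocity. -/
theorem exists_weight_split {α ℓ : ℝ} (hα : 0 ≤ α) {p₁ p : ℝ≥0∞ × ℝ≥0∞} (hx₁ : 1 ≤ p₁.1)
    (hv₁ : 1 ≤ p₁.2) (hpx : p.1 ≠ ∞) (hpv : p.2 ≠ ∞) (hx : p₁.1 ≤ p.1) (hv : p₁.2 ≤ p.2)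
    (hℓ : (p₁ = p ∧ ℓ = 0) ∨ (p₁ ≠ p ∧ gap d α p₁ p < ℓ)) :
    ∃ k l : ℝ, 0 ≤ k ∧ 0 ≤ l ∧ k + l = ℓ ∧
      (p₁.1.toReal = p.1.toReal ∨ (p₁.1.toReal < p.1.toReal ∧
        (1 + α) * d * (1 / p₁.1.toReal - 1 / p.1.toReal) < k)) ∧
      (p₁.2.toReal = p.2.toReal ∨ (p₁.2.toReal < p.2.toReal ∧
        d * (1 / p₁.2.toReal - 1 / p.2.toReal) < l)) := by
  have hx₁' : 1 ≤ p₁.1.toReal := by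
    simpa using ENNReal.toReal_mono (ne_top_of_le_ne_top hpx hx) hx₁
  have hv₁' : 1 ≤ p₁.2.toReal := by
    simpa using ENNReal.toReal_mono (ne_top_of_le_ne_top hpv hv) hv₁
  have hxx := ENNReal.toReal_mono hpx hx
  have hvv := ENNReal.toReal_mono hpv hv
  have hgx : 0 ≤ (1 + α) * d * (1 / p₁.1.toReal - 1 / p.1.toReal) :=
    mul_nonneg (by positivity) (sub_nonneg.2 (one_div_le_one_div_of_le (by linarith) hxx))
  have hgv : 0 ≤ d * (1 / p₁.2.toReal - 1 / p.2.toReal) :=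
    mul_nonneg (by positivity) (sub_nonneg.2 (one_div_le_one_div_of_le (by linarith) hvv))
  rcases hℓ with ⟨rfl, rfl⟩ | ⟨hne, hgap⟩
  · exact ⟨0, 0, le_rfl, le_rfl, add_zero 0, .inl rfl, .inl rfl⟩
  simp only [gap, ENNReal.toReal_inv] at hgap
  simp only [← one_div] at hgap
  rcases hxx.eq_or_lt with ex | lx <;> rcases hvv.eq_or_lt with ev | lv
  · refine absurd (Prod.ext ?_ ?_) hne
    · exact (ENNReal.toReal_eq_toReal_iff' (ne_top_of_le_ne_top hpx hx) hpx).1 ex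
    · exact (ENNReal.toReal_eq_toReal_iff' (ne_top_of_le_ne_top hpv hv) hpv).1 ev
  -- When one pair of exponents agrees, its gap vanishes and the other variable takes all of ℓ.
  · exact ⟨0, ℓ, le_rfl, by linarith, zero_add ℓ, .inl ex, .inr ⟨lv, by linarith⟩⟩
  · exact ⟨ℓ, 0, by linarith, le_rfl, add_zero ℓ, .inr ⟨lx, by linarith⟩, .inl ev⟩
  · set gx := (1 + α) * d * (1 / p₁.1.toReal - 1 / p.1.toReal)
    set gv := d * (1 / p₁.2.toReal - 1 / p.2.toReal)
    -- Both inequalities must be strict, so the surplus of ℓ over the total gap is shared equally.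
    exact ⟨gx + (ℓ - gx - gv) / 2, gv + (ℓ - gx - gv) / 2, by linarith, by linarith, by ring,
      .inr ⟨lx, by linarith⟩, .inr ⟨lv, by linarith⟩⟩

/-- The moment bound for one dyadic block. -/
theorem exists_lpn_block_le {α k l a₁ b₁ a b q : ℝ} {m : ℕ} (hα : 0 ≤ α) (hk : 0 ≤ k) (hl : 0 ≤ l)
    (ha₁ : 0 < a₁) (hb₁ : 0 < b₁) (ha : 1 ≤ a) (hb : 1 ≤ b) (hm : 1 ≤ m) (hq : 0 < q)
    (hq2 : q ≤ 2) (hqa : q ≤ a) (hqb : q ≤ b) (hqm : q ≤ m)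
    (hx : a₁ = a ∨ (a₁ < a ∧ (1 + α) * d * (1 / a₁ - 1 / a) < k))
    (hv : b₁ = b ∨ (b₁ < b ∧ d * (1 / b₁ - 1 / b) < l))
    (χ : Cutoff d α) (φ : 𝓢(Phase d, ℝ)) : ∃ C : ℝ≥0∞, C ≠ ∞ ∧
    ∀ (μ : Measure (Phase d)) [IsProbabilityMeasure μ] (N : ℕ), 1 ≤ N → ∀ lam : ℝ, 1 ≤ lam →
    ∀ j : ℕ, lpn m (Measure.pi fun _ : Fin N => μ) (fun x => mixn a₁ b₁ fun z =>
        ‖χ.block j (mollifiedDiff α lam φ (empirical x) μ) z‖ₑ) ≤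
      C * lpn m μ (phaseWt α k l) * ENNReal.ofReal ((N : ℝ) ^ (1 / q - 1)) *
        ENNReal.ofReal (lam ^ ((1 + α) * d * (1 - 1 / a) + d * (1 - 1 / b))) := by
  have ha0 : 0 < a := by linarith
  have hb0 : 0 < b := by linarith
  have hm0 : (0 : ℝ) < m := by exact_mod_cast hm
  obtain ⟨C, hC, hCw⟩ := exists_mixn_le_weighted (d := d) hα hk hl ha₁ hb₁ ha0 hx hv
  obtain ⟨K, hK, hKs⟩ := exists_lpn_centered_sum_le (d := d) ha hb hm hq hq2 hqa hqb hqm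
  set W := phaseWt (d := d) α k l with hW
  have hWm : Measurable W := measurable_phaseWt α k l
  set A := ∫⁻ z, W z * ‖invFourier χ.fn z‖ₑ with hA
  have hAfin : A ≠ ∞ := by
    have hWf : Measurable fun z => W z * ‖invFourier χ.fn z‖ₑ :=
      hWm.mul (SchwartzMap.continuous _).measurable.enorm
    rw [hA, ← mixn_one_one hWf]
    exact (mixn_phaseWt_mul_schwartz_lt_top hα hk hl one_pos one_pos _).ne
  set R := mixn a b fun z => W z * ‖φ z‖ₑ with hR
  have hRfin : R ≠ ∞ := (mixn_phaseWt_mul_schwartz_lt_top hα hk hl ha0 hb0 φ).ne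
  refine ⟨C * K * (2 * A) * R, by finiteness, fun μ _ N hN lam hlam j => ?_⟩
  set H := convFn (invFourier (χ.piece j)) (dilate α lam φ) with hH
  have hgm : Measurable (invFourier (χ.piece j)) := (SchwartzMap.continuous _).measurable
  have hfm : Measurable (dilate α lam φ) := (continuous_dilate α lam φ).measurable
  have hHm : Measurable H := measurable_convFn hgm hfm
  obtain ⟨B, hB⟩ := exists_norm_dilate_le α lam φ
  set c : Phase d → ℂ := fun z => ∫ y, H (z - y) ∂μ with hc
  have hcm : Measurable c := by
    have h : StronglyMeasurable fun z : Phase d × Phase d => H (z.1 - z.2) :=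
      (hHm.comp (measurable_fst.sub measurable_snd)).stronglyMeasurable
    exact h.integral_prod_right.measurable
  have hsum : Measurable (Function.uncurry fun (z : Phase d) (x : Fin N → Phase d) =>
      W z * ‖∑ i, (H (z - x i) - c z)‖ₑ) := by
    refine (hWm.comp measurable_fst).mul (Measurable.enorm ?_)
    refine Finset.measurable_sum _ fun i _ => ?_
    fun_prop
  have hN0 : (0 : ℝ) < N := by exact_mod_cast hN
  have hpt : ∀ x : Fin N → Phase d, mixn a₁ b₁ (fun z =>
      ‖χ.block j (mollifiedDiff α lam φ (empirical x) μ) z‖ₑ) ≤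
        (C * (N : ℝ≥0∞)⁻¹) * mixn a b fun z => W z * ‖∑ i, (H (z - x i) - c z)‖ₑ := fun x => by
    have hxm : Measurable fun z => ‖∑ i, (H (z - x i) - c z)‖ₑ := by
      refine Measurable.enorm (Finset.measurable_sum _ fun i _ => ?_)
      fun_prop
    have he : ∀ z, ‖χ.block j (mollifiedDiff α lam φ (empirical x) μ) z‖ₑ =
        (N : ℝ≥0∞)⁻¹ * ‖∑ i, (H (z - x i) - c z)‖ₑ := fun z => by
      rw [block_empirical χ j lam φ hN, enorm_mul]
      congr 1
      rw [← ofReal_norm, norm_inv, Complex.norm_natCast, ENNReal.ofReal_inv_of_pos hN0,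
        ENNReal.ofReal_natCast]
    simp only [he]
    rw [mixn_const_mul ha₁ hb₁ _ hxm, mul_comm C, mul_assoc]
    gcongr
    exact hCw _ hxm
  have hHR : mixn a b (fun z => W z * ‖H z‖ₑ) ≤ 2 * A *
      (ENNReal.ofReal (lam ^ ((1 + α) * d * (1 - 1 / a) + d * (1 - 1 / b))) * R) :=
    (mixn_phaseWt_convFn_le hα hk hl ha hb hgm hfm).trans (mul_le_mul'
      (lintegral_phaseWt_invFourier_piece_le hα hk hl χ j)
      (mixn_phaseWt_dilate_le hα hk hl ha0 hb0 φ hlam))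
  have hNN : (N : ℝ≥0∞)⁻¹ * (N : ℝ≥0∞) ^ (1 / q) = ENNReal.ofReal ((N : ℝ) ^ (1 / q - 1)) := by
    rw [← ENNReal.ofReal_natCast, ← ENNReal.ofReal_inv_of_pos hN0, ENNReal.ofReal_rpow_of_pos hN0,
      ← ENNReal.ofReal_mul (by positivity), Real.rpow_sub_one hN0.ne', mul_comm, ← div_eq_mul_inv]
  calc _ ≤ lpn m (Measure.pi fun _ : Fin N => μ) (fun x => (C * (N : ℝ≥0∞)⁻¹) *
          mixn a b fun z => W z * ‖∑ i, (H (z - x i) - c z)‖ₑ) := lpn_mono hm0 hpt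
    _ = (C * (N : ℝ≥0∞)⁻¹) * lpn m (Measure.pi fun _ : Fin N => μ) (fun x =>
          mixn a b fun z => W z * ‖∑ i, (H (z - x i) - c z)‖ₑ) :=
        lpn_const_mul hm0 _ _ (measurable_mixn hsum a b)
    _ ≤ (C * (N : ℝ≥0∞)⁻¹) * (K * (N : ℝ≥0∞) ^ (1 / q) * lpn m μ W * (2 * A *
          (ENNReal.ofReal (lam ^ ((1 + α) * d * (1 - 1 / a) + d * (1 - 1 / b))) * R))) := by
        gcongr
        refine (hKs W hWm (phaseWt_add_le hα hk hl) H hHm _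
          (norm_convFn_le (SchwartzMap.integrable _) hB) μ N).trans ?_
        gcongr
    _ = (C * K * (2 * A) * R) * lpn m μ W * ((N : ℝ≥0∞)⁻¹ * (N : ℝ≥0∞) ^ (1 / q)) *
          ENNReal.ofReal (lam ^ ((1 + α) * d * (1 - 1 / a) + d * (1 - 1 / b))) := by ring
    _ = _ := by rw [hNN]

theorem measurable_mixn_block {α : ℝ} (χ : Cutoff d α) (j : ℕ) (lam : ℝ) (φ : 𝓢(Phase d, ℝ))
    (hN : 1 ≤ N) (μ : Measure (Phase d)) [IsProbabilityMeasure μ] (a b : ℝ) :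
    Measurable fun x : Fin N → Phase d => mixn a b fun z =>
      ‖χ.block j (mollifiedDiff α lam φ (empirical x) μ) z‖ₑ := by
  simp only [block_empirical χ j lam φ hN]
  set H := convFn (invFourier (χ.piece j)) (dilate α lam φ) with hH
  have hHm : Measurable H := measurable_convFn (SchwartzMap.continuous _).measurable
    (continuous_dilate α lam φ).measurable
  have hcm : Measurable fun z => ∫ y, H (z - y) ∂μ := by
    have h : StronglyMeasurable fun z : Phase d × Phase d => H (z.1 - z.2) :=
      (hHm.comp (measurable_fst.sub measurable_snd)).stronglyMeasurable
    exact h.integral_prod_right.measurable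
  refine measurable_mixn (F := fun z (x : Fin N → Phase d) =>
    ‖(N : ℂ)⁻¹ * ∑ i, (H (z - x i) - ∫ y, H (z - y) ∂μ)‖ₑ) ?_ a b
  refine Measurable.enorm (Measurable.const_mul (Finset.measurable_sum _ fun i _ => ?_) _)
  exact (hHm.comp (by fun_prop)).sub (hcm.comp measurable_fst)

end Empirical

end AnisoBesov

end

/-! ### Summation over the dyadic blocks -/

theorem theoremC3 {d : ℕ} (hd : 0 < d) {α : ℝ} (hα : 1 < α) (hα' : α ≤ 2)
    (χ : Cutoff d α) (φ : 𝓢(Phase d, ℝ))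
    (p₁ p : ℝ≥0∞ × ℝ≥0∞)
    (hp₁x : 1 ≤ p₁.1) (hp₁v : 1 ≤ p₁.2)
    (hpx : 1 < p.1) (hpv : 1 < p.2) (hpx' : p.1 < ∞) (hpv' : p.2 < ∞)
    (hx : p₁.1 ≤ p.1) (hv : p₁.2 ≤ p.2)
    (ℓ : ℝ) (hℓ : (p₁ = p ∧ ℓ = 0) ∨ (p₁ ≠ p ∧ gap d α p₁ p < ℓ))
    (q : ℝ) (hq : q = (min (min p.1 p.2) 2).toReal)
    (β : ℝ) (hβ : β < 0) (m : ℕ) (hm : 1 < m) :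
    ∃ C : ℝ, 0 < C ∧
      ∀ (Ω : Type*) [MeasurableSpace Ω] (P : Measure Ω) [IsProbabilityMeasure P]
        (μ : Measure (Phase d)) [IsProbabilityMeasure μ],
        Integrable (fun z => anorm α z ^ (ℓ * m)) μ →
        ∀ (N : ℕ), 1 ≤ N →
        ∀ (ξ : Fin N → Ω → Phase d),
          (∀ i, Measurable (ξ i)) → iIndepFun ξ P → (∀ i, P.map (ξ i) = μ) →
        ∀ (lam : ℝ), 1 ≤ lam →
          Measurable (fun ω => χ.besovNorm β 1 p₁
            (mollifiedDiff α lam φ (empirical fun i => ξ i ω) μ)) ∧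
          eLpNorm (fun ω => χ.besovNorm β 1 p₁
              (mollifiedDiff α lam φ (empirical fun i => ξ i ω) μ)) m P ≤
            ENNReal.ofReal (C * (1 + ∫ z, anorm α z ^ (ℓ * m) ∂μ) ^ (1 / (m : ℝ))
              * (N : ℝ) ^ (1 / q - 1) * lam ^ gap d α (1, 1) p) := by
  have hα0 : 0 ≤ α := by linarith
  obtain ⟨k, l, hk, hl, rfl, hxs, hvs⟩ := exists_weight_split (d := d) hα0 hp₁x hp₁v hpx'.ne
    hpv'.ne hx hv hℓ
  have hx₁top : p₁.1 ≠ ∞ := ne_top_of_le_ne_top hpx'.ne hx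
  have hv₁top : p₁.2 ≠ ∞ := ne_top_of_le_ne_top hpv'.ne hv
  have toReal_ge : ∀ {r : ℝ≥0∞}, r ≠ ∞ → 1 ≤ r → 1 ≤ r.toReal := fun hr h => by
    simpa using ENNReal.toReal_mono hr h
  have hmin : min (min p.1 p.2) 2 ≠ ∞ := ne_top_of_le_ne_top (by simp) (min_le_right _ _)
  have hq0 : 0 < q := by
    rw [hq]
    exact zero_lt_one.trans_le (toReal_ge hmin (le_min (le_min hpx.le hpv.le) (by norm_num)))
  have hq2 : q ≤ 2 := by
    rw [hq]; simpa using ENNReal.toReal_mono (by simp) (min_le_right (min p.1 p.2) 2)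
  have hqa : q ≤ p.1.toReal := by
    rw [hq]; exact ENNReal.toReal_mono hpx'.ne ((min_le_left _ _).trans (min_le_left _ _))
  have hqb : q ≤ p.2.toReal := by
    rw [hq]; exact ENNReal.toReal_mono hpv'.ne ((min_le_left _ _).trans (min_le_right _ _))
  -- For an integer, m > 1 means m ≥ 2 ≥ q, as the type-q inequality requires.
  have hm2 : (2 : ℝ) ≤ m := by exact_mod_cast hm
  have hm0 : (0 : ℝ) < m := by linarith
  obtain ⟨C, hC, hCb⟩ := exists_lpn_block_le (d := d) (m := m) hα0 hk hl
    (zero_lt_one.trans_le (toReal_ge hx₁top hp₁x)) (zero_lt_one.trans_le (toReal_ge hv₁top hp₁v))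
    (toReal_ge hpx'.ne hpx.le) (toReal_ge hpv'.ne hpv.le) hm.le hq0 hq2 hqa hqb (hq2.trans hm2)
    hxs hvs χ φ
  set S := ∑' j : ℕ, ENNReal.ofReal ((2 : ℝ) ^ ((j : ℝ) * β)) with hS
  have hSfin : S ≠ ∞ := tsum_ofReal_two_rpow_ne_top hβ
  have hCS : S * C ≠ ∞ := ENNReal.mul_ne_top hSfin hC
  -- S sums the weights 2^{jβ}, C is the block constant, 2^{k+l} comes from the moment of the
  -- weight, and the 1 secures positivity.
  refine ⟨((S * C).toReal + 1) * 2 ^ (k + l), by positivity,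
    fun Ω _ P _ μ _ hμ N hN ξ hξ hind hlaw lam hlam => ?_⟩
  set Φ : ℕ → (Fin N → Phase d) → ℝ≥0∞ := fun j x => mixn p₁.1.toReal p₁.2.toReal fun z =>
    ‖χ.block j (mollifiedDiff α lam φ (empirical x) μ) z‖ₑ with hΦ
  have hΦm : ∀ j, Measurable (Φ j) := fun j => measurable_mixn_block χ j lam φ hN μ _ _
  set Ψ : (Fin N → Phase d) → ℝ≥0∞ := fun x =>
    ∑' j : ℕ, ENNReal.ofReal ((2 : ℝ) ^ ((j : ℝ) * β)) * Φ j x with hΨ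
  have hΨm : Measurable Ψ := Measurable.tsum fun j => (hΦm j).const_mul _
  have hbes : ∀ ω, χ.besovNorm β 1 p₁ (mollifiedDiff α lam φ (empirical fun i => ξ i ω) μ) =
      Ψ fun i => ξ i ω := fun ω => by
    rw [besovNorm_one_eq_tsum]
    simp only [mixedNorm_eq_mixn (zero_lt_one.trans_le hp₁x).ne' hx₁top
      (zero_lt_one.trans_le hp₁v).ne' hv₁top, hΨ, hΦ]
  have hξm : Measurable fun ω i => ξ i ω := measurable_pi_lambda _ hξ
  -- Independence enters only here: the sample has the product law, so the estimate transfers from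
  -- the product space.
  have hmp : MeasurePreserving (fun ω i => ξ i ω) P (Measure.pi fun _ : Fin N => μ) := by
    refine ⟨hξm, ?_⟩
    rw [(iIndepFun_iff_map_fun_eq_pi_map fun i => (hξ i).aemeasurable).1 hind]
    simp only [hlaw]
  simp only [hbes]
  refine ⟨hΨm.comp hξm, ?_⟩
  have hgap : gap d α (1, 1) p =
      (1 + α) * d * (1 - 1 / p.1.toReal) + d * (1 - 1 / p.2.toReal) := by
    simp [gap, ENNReal.toReal_inv]
  set I := ∫ z, anorm α z ^ ((k + l) * m) ∂μ with hI
  have hI0 : 0 ≤ I := integral_nonneg fun z => Real.rpow_nonneg (by unfold anorm; positivity) _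
  calc eLpNorm (fun ω => Ψ fun i => ξ i ω) m P
      = lpn m P (fun ω => Ψ fun i => ξ i ω) := by
        rw [lpn_eq_eLpNorm (by exact_mod_cast (by omega : m ≠ 0)) (by simp)]
        simp only [ENNReal.toReal_natCast, enorm_eq_self]
    _ = lpn m (Measure.pi fun _ : Fin N => μ) Ψ := lpn_comp hmp hΨm
    _ ≤ ∑' j : ℕ, lpn m (Measure.pi fun _ : Fin N => μ) fun x =>
          ENNReal.ofReal ((2 : ℝ) ^ ((j : ℝ) * β)) * Φ j x :=
        lpn_tsum_le (by linarith) _ fun j => (hΦm j).const_mul _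
    _ ≤ ∑' j : ℕ, ENNReal.ofReal ((2 : ℝ) ^ ((j : ℝ) * β)) *
          (C * lpn m μ (phaseWt α k l) * ENNReal.ofReal ((N : ℝ) ^ (1 / q - 1)) *
            ENNReal.ofReal (lam ^ gap d α (1, 1) p)) := by
        refine ENNReal.tsum_le_tsum fun j => ?_
        rw [lpn_const_mul hm0 _ _ (hΦm j), hgap]
        gcongr
        exact hCb μ N hN lam hlam j
    _ = (S * C) * lpn m μ (phaseWt α k l) * ENNReal.ofReal ((N : ℝ) ^ (1 / q - 1)) *
          ENNReal.ofReal (lam ^ gap d α (1, 1) p) := by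
        rw [ENNReal.tsum_mul_right, ← hS]
        ring
    _ ≤ ENNReal.ofReal ((S * C).toReal + 1) *
          ENNReal.ofReal (2 ^ (k + l) * (1 + I) ^ (1 / (m : ℝ))) *
          ENNReal.ofReal ((N : ℝ) ^ (1 / q - 1)) * ENNReal.ofReal (lam ^ gap d α (1, 1) p) := by
        gcongr
        · rw [← ENNReal.ofReal_toReal hCS]
          simp only [ENNReal.toReal_ofReal ENNReal.toReal_nonneg]
          exact ENNReal.ofReal_le_ofReal (by linarith)
        · exact lpn_phaseWt_le (by omega) hk hl μ hμ
    _ = _ := by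
        rw [← ENNReal.ofReal_mul (by positivity), ← ENNReal.ofReal_mul (by positivity),
          ← ENNReal.ofReal_mul (by positivity)]
        congr 1
        ring
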